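/- Let $G$ be a second countable, locally compact, Hausdorff group with (left) Haar measure $\mu_G$, and let $E$ be a co-compact model of the universal proper $G$-space: a locally compact Hausdorff space with a proper, co-compact $G$-action such that every proper ($\sigma$-compact, locally compact, Hausdorff) $G$-space has a continuous $G$-map to $E$, unique up to $G$-homotopy. $G$ acts on functions on $E$ by $(g\phi)(x)=\phi(g^{-1}x)$. A cut-off function on $E$ is a continuous, compactly supported function $c\ge 0$ on $E$ with $\int_G g(c)^2\,d\mu_G(g)=1$. Let $H$ be a separable, graded $G$-Hilbert space (a grading operator and a strongly continuous, even unitary representation $u$ of $G$), and write $g(S)=u_gSu_g^*$ for an operator $S$. Write $K(H)$ for the compact operators on $H$. A $G$-equivariant Kasparov cycle is a pair $(H,T)$ with $T$ an odd, bounded, self-adjoint operator on $H$ such that $1-T^2\in K(H)$ and $g(T)-T\in K(H)$ for all $g\in G$. Homotopies of cycles are taken in the sense of Kasparov, i.e. they are given by cycles on countably generated graded Hilbert $C([0,1])$-modules; $1_G$ denotes the cycle $(\mathbb C\oplus 0,\,0)$ with the trivial representation. Representations of $C_0(E)$ on $H$ are by even operators. The cycle $(H,T)$ is called *proper* if there is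 a non-degenerate, $G$-equivariant representation of $C_0(E)$ on $H$ such that * (ii.i) the function $g\mapsto [g(\phi),T]$ is in $C_0(G,K(H))$ for every $\phi\in C_0(E)$; * (ii.ii) $\int_G g(c)\,T\,g(c)\,d\mu_G(g)-T\in K(H)$ for some cut-off function $c$ on $E$ (weak integral). It has *property $(\gamma)$* if it is proper and (i) $[H,T]=1_K$ in $R(K)=KK^K(\mathbb C,\mathbb C)$, i.e. $(H,T)$ is homotopic to $1_K$ as a $K$-equivariant cycle, for every compact subgroup $K$ of $G$. **Theorem.** Let $D$ be an odd, unbounded, densely defined, (essentially) self-adjoint operator on $H$ with compact resolvent which is almost $G$-equivariant: $G$ preserves the domain of $D$ and $g(D)-D$ is bounded for every $g\in G$. Let $T=D(1+D^2)^{-1/2}$ be its bounded transform (formed with the closure of $D$). Suppose that there are a non-degenerate, $G$-equivariant representation of $C_0(E)$ on $H$ and a $G$-invariant subalgebra $B$ of $C_c(E)$, dense in $C_0(E)$, which preserves the domain of $D$, such that for every $b\in B$ there are $\chi\in C_c(E)$ and bounded operators $(b_g)_{g\in G}$ on $H$, uniformly bounded in $g$, with $$[D,g(b)]=b_g\,g(\chi)\qquad\text{on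 the domain of } D,\text{ for all } g\in G.$$ Suppose also that $B$ contains a cut-off function on $E$. Then $(H,T)$ is a $G$-equivariant Kasparov cycle, and it is proper; indeed the given representation of $C_0(E)$ satisfies (ii.i) and (ii.ii). If moreover $(H,T)$ is $K$-equivariantly homotopic to $1_K$ for every compact subgroup $K$ of $G$, then $(H,T)$ has property $(\gamma)$. -/

import Mathlib

open MeasureTheory Filter Topology
open scoped ZeroAtInfty ComplexOrder unitInterval

universe u v

/-! ### Proper `G`-spaces -/

/-- A proper `G`-space `E` is universal if every (locally compact, σ-compact, Hausdorff) proper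
`G`-space `X` admits a continuous `G`-map to `E`, and any two such maps are homotopic through
`G`-maps. -/
structure IsUniversalProper (G : Type u) (E : Type v) [Group G] [TopologicalSpace G]
    [TopologicalSpace E] [MulAction G E] : Prop where
  exists_map : ∀ (X : Type (max u v)) [TopologicalSpace X] [T2Space X] [LocallyCompactSpace X]
    [SigmaCompactSpace X] [MulAction G X] [ProperSMul G X],
    ∃ f : C(X, E), ∀ (g : G) (x : X), f (g • x) = g • f x
  unique_up_to_homotopy : ∀ (X : Type (max u v)) [TopologicalSpace X] [T2Space X]
    [LocallyCompactSpace X] [SigmaCompactSpace X] [MulAction G X] [ProperSMul G X]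
    (f₀ f₁ : C(X, E)), (∀ (g : G) (x : X), f₀ (g • x) = g • f₀ x) →
    (∀ (g : G) (x : X), f₁ (g • x) = g • f₁ x) →
    ∃ F : f₀.Homotopy f₁, ∀ (g : G) (t : I) (x : X), F (t, g • x) = g • F (t, x)

/-- The action of `G` on `C₀(E)`: `(g φ)(x) = φ (g⁻¹ x)`. -/
noncomputable def c0Translate {G E : Type*} [Group G] [TopologicalSpace E] [MulAction G E]
    [ContinuousConstSMul G E] (g : G) (φ : C₀(E, ℂ)) : C₀(E, ℂ) :=
  φ.comp (Homeomorph.smul g⁻¹).toCocompactMap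

theorem c0Translate_apply {G E : Type*} [Group G] [TopologicalSpace E] [MulAction G E]
    [ContinuousConstSMul G E] (g : G) (φ : C₀(E, ℂ)) (x : E) :
    c0Translate g φ x = φ (g⁻¹ • x) := rfl

/-- Cut-off functions: continuous, compactly supported, non-negative functions `c` with
`∫ (g c)² dμ(g) = 1` at every point. -/
structure IsCutoff {G E : Type*} [Group G] [MeasurableSpace G] [TopologicalSpace E]
    [MulAction G E] (μ : Measure G) (c : C₀(E, ℂ)) : Prop where
  hasCompactSupport : HasCompactSupport c
  nonneg : ∀ x, 0 ≤ c x
  integral_sq : ∀ x, ∫ g, c (g⁻¹ • x) ^ 2 ∂μ = 1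

/-! ### Graded `G`-Hilbert spaces and Kasparov cycles -/

/-- A grading and a (strongly continuous, even) unitary representation of `G` on a Hilbert
space `H`. -/
structure GradedRep (G H : Type*) [Group G] [TopologicalSpace G] [NormedAddCommGroup H]
    [InnerProductSpace ℂ H] where
  /-- the grading operator: `1` on the even part, `-1` on the odd part -/
  grading : H ≃ₗᵢ[ℂ] H
  grading_grading : ∀ v, grading (grading v) = v
  /-- the unitary representation `g ↦ u_g` -/
  rep : G →* (H ≃ₗᵢ[ℂ] H)
  continuous_rep : ∀ v, Continuous fun g => rep g v
  rep_even : ∀ g v, grading (rep g v) = rep g (grading v)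

namespace GradedRep

variable {G H : Type*} [Group G] [TopologicalSpace G] [NormedAddCommGroup H]
  [InnerProductSpace ℂ H]

/-- `g(T) = u_g T u_g*`. -/
noncomputable def conj (S : GradedRep G H) (g : G) (T : H →L[ℂ] H) : H →L[ℂ] H :=
  (S.rep g : H →L[ℂ] H) ∘L T ∘L (S.rep g⁻¹ : H →L[ℂ] H)

/-- Restriction of the group action to a subgroup. -/
def restrict (S : GradedRep G H) (K : Subgroup G) : GradedRep K H where
  grading := S.grading
  grading_grading := S.grading_grading
  rep := S.rep.comp K.subtype
  continuous_rep v := (S.continuous_rep v).comp continuous_subtype_val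
  rep_even g v := S.rep_even g v

/-- The trivial representation of `G` on `ℂ ⊕ 0`. -/
noncomputable def unit (G : Type*) [Group G] [TopologicalSpace G] : GradedRep G ℂ where
  grading := LinearIsometryEquiv.refl ℂ ℂ
  grading_grading _ := rfl
  rep := 1
  continuous_rep _ := continuous_const
  rep_even _ _ := rfl

end GradedRep

/-- `(H, T)` is a `G`-equivariant Kasparov cycle. -/
structure IsKasparovCycle {G H : Type*} [Group G] [TopologicalSpace G] [NormedAddCommGroup H]
    [InnerProductSpace ℂ H] [CompleteSpace H] (S : GradedRep G H) (T : H →L[ℂ] H) : Prop where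
  separable : TopologicalSpace.SeparableSpace H
  odd : ∀ v, T (S.grading v) = -S.grading (T v)
  isSelfAdjoint : IsSelfAdjoint T
  fredholm : IsCompactOperator (1 - T * T : H →L[ℂ] H)
  almost_equivariant : ∀ g, IsCompactOperator (S.conj g T - T : H →L[ℂ] H)

/-! ### Homotopy of Kasparov cycles

A homotopy is a Kasparov cycle over `C([0,1])`: a countably generated (for the separable
coefficient algebra `C([0,1])`, this means separable) graded Hilbert `C([0,1])`-module with an action
of `G` and an odd self-adjoint operator `F`. -/

/-- The compact operators on a Hilbert `A`-module `M`: the norm closure of the span of the rank one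
operators `z ↦ x ⟨y, z⟩`. -/
def moduleCompacts (A M : Type*) [NonUnitalSemiring A] [StarRing A] [Module ℂ A] [PartialOrder A]
    [Norm A] [NormedAddCommGroup M] [NormedSpace ℂ M] [SMul A M] [CStarModule A M] :
    Set (M →L[ℂ] M) :=
  closure (Submodule.span ℂ {f : M →L[ℂ] M | ∃ x y : M, ∀ z, f z = inner A y z • x} :
    Set (M →L[ℂ] M))

/-- A `G`-equivariant Kasparov cycle on the Hilbert `C([0,1])`-module `M`. -/
structure ModuleCycle (G M : Type*) [Group G] [TopologicalSpace G] [NormedAddCommGroup M]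
    [NormedSpace ℂ M] [SMul C(I, ℂ) M] [CStarModule C(I, ℂ) M] where
  grading : M ≃ₗᵢ[ℂ] M
  grading_grading : ∀ x, grading (grading x) = x
  inner_grading : ∀ x y, inner C(I, ℂ) (grading x) (grading y) = inner C(I, ℂ) x y
  rep : G →* (M ≃ₗᵢ[ℂ] M)
  inner_rep : ∀ g x y, inner C(I, ℂ) (rep g x) (rep g y) = inner C(I, ℂ) x y
  continuous_rep : ∀ x, Continuous fun g => rep g x
  rep_even : ∀ g x, grading (rep g x) = rep g (grading x)
  /-- the operator of the cycle -/
  op : M →L[ℂ] M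
  op_selfAdjoint : ∀ x y, inner C(I, ℂ) (op x) y = inner C(I, ℂ) x (op y)
  op_odd : ∀ x, op (grading x) = -grading (op x)
  fredholm : 1 - op * op ∈ moduleCompacts C(I, ℂ) M
  almost_equivariant : ∀ g,
    (rep g : M →L[ℂ] M) ∘L op ∘L (rep g⁻¹ : M →L[ℂ] M) - op ∈ moduleCompacts C(I, ℂ) M

/-- The evaluation of a cycle over `C([0,1])` at `t` is (unitarily equivalent to) `(H, T)`: there is
a map `r : M → H` with dense range and `⟨r x, r y⟩ = ⟨x, y⟩(t)`, which therefore identifies the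
fibre `M ⊗_{ev_t} ℂ` with `H`, and `r` intertwines all the structure. -/
def ModuleCycle.EvaluatesTo {G M H : Type*} [Group G] [TopologicalSpace G]
    [NormedAddCommGroup M] [NormedSpace ℂ M] [SMul C(I, ℂ) M] [CStarModule C(I, ℂ) M]
    [NormedAddCommGroup H] [InnerProductSpace ℂ H]
    (𝓜 : ModuleCycle G M) (t : I) (S : GradedRep G H) (T : H →L[ℂ] H) : Prop :=
  ∃ r : M →ₗ[ℂ] H, DenseRange r ∧
    (∀ x y, inner ℂ (r x) (r y) = inner C(I, ℂ) x y t) ∧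
    (∀ x, r (𝓜.grading x) = S.grading (r x)) ∧
    (∀ g x, r (𝓜.rep g x) = S.rep g (r x)) ∧
    (∀ x, r (𝓜.op x) = T (r x))

/-- Homotopy of `G`-equivariant Kasparov cycles. (A separable module has at most the cardinality of
the continuum, so that it is no restriction to take it in `Type`.) -/
def KasparovHomotopic {G H₀ H₁ : Type*} [Group G] [TopologicalSpace G]
    [NormedAddCommGroup H₀] [InnerProductSpace ℂ H₀] [NormedAddCommGroup H₁]
    [InnerProductSpace ℂ H₁] (S₀ : GradedRep G H₀) (T₀ : H₀ →L[ℂ] H₀) (S₁ : GradedRep G H₁)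
    (T₁ : H₁ →L[ℂ] H₁) : Prop :=
  ∃ (M : Type) (_ : NormedAddCommGroup M) (_ : NormedSpace ℂ M) (_ : CompleteSpace M)
    (_ : TopologicalSpace.SeparableSpace M) (_ : SMul C(I, ℂ) M) (_ : CStarModule C(I, ℂ) M)
    (𝓜 : ModuleCycle G M), 𝓜.EvaluatesTo 0 S₀ T₀ ∧ 𝓜.EvaluatesTo 1 S₁ T₁

/-- `(H, T)`, viewed as a `K`-equivariant cycle, is homotopic to `1_K = [ℂ ⊕ 0, 0]`, for every
compact subgroup `K` of `G`; that is, `[H, T] = 1_K` in `R(K)`. -/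
def IsUnitOnCompacts {G H : Type*} [Group G] [TopologicalSpace G] [NormedAddCommGroup H]
    [InnerProductSpace ℂ H] (S : GradedRep G H) (T : H →L[ℂ] H) : Prop :=
  ∀ K : Subgroup G, IsCompact (K : Set G) →
    KasparovHomotopic (S.restrict K) T (GradedRep.unit K) (0 : ℂ →L[ℂ] ℂ)

/-! ### Property (γ) -/

/-- A non-degenerate, `G`-equivariant representation of `C₀(E)` on a graded `G`-Hilbert space, by
even operators. -/
structure EquivariantRep {G H : Type*} [Group G] [TopologicalSpace G] [NormedAddCommGroup H]
    [InnerProductSpace ℂ H] [CompleteSpace H] (S : GradedRep G H) (E : Type*)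
    [TopologicalSpace E] [MulAction G E] [ContinuousConstSMul G E] where
  /-- the underlying `*`-homomorphism -/
  hom : C₀(E, ℂ) →⋆ₙₐ[ℂ] (H →L[ℂ] H)
  even : ∀ φ v, hom φ (S.grading v) = S.grading (hom φ v)
  equivariant : ∀ g φ, hom (c0Translate g φ) = S.conj g (hom φ)
  nondegenerate : Dense (Submodule.span ℂ {w : H | ∃ φ v, w = hom φ v} : Set H)

/-- `R = ∫ f(g) dμ(g)` in the weak sense. -/
def IsWeakIntegral {G H : Type*} [MeasurableSpace G] [NormedAddCommGroup H]
    [InnerProductSpace ℂ H] (μ : Measure G) (f : G → H →L[ℂ] H) (R : H →L[ℂ] H) : Prop :=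
  ∀ v w, Integrable (fun g => inner ℂ v (f g w)) μ ∧ ∫ g, inner ℂ v (f g w) ∂μ = inner ℂ v (R w)

section

variable {G H : Type*} [Group G] [TopologicalSpace G] [MeasurableSpace G] [NormedAddCommGroup H]
  [InnerProductSpace ℂ H] [CompleteSpace H]

/-- `[S, T] = S T - T S`. -/
noncomputable def opCommutator (S T : H →L[ℂ] H) : H →L[ℂ] H := S * T - T * S

/-- The two conditions of properness for a given representation of `C₀(E)`: the function
`g ↦ [g(φ), T]` is in `C₀(G, K(H))` for all `φ` in `C₀(E)`, and `∫ g(c) T g(c) dμ(g) - T` is compact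
for some cut-off function `c`. -/
structure ProperConditions (μ : Measure G) {S : GradedRep G H} {E : Type*} [TopologicalSpace E]
    [MulAction G E] [ContinuousConstSMul G E] (π : EquivariantRep S E) (T : H →L[ℂ] H) :
    Prop where
  commutator_continuous : ∀ φ, Continuous fun g : G => opCommutator (π.hom (c0Translate g φ)) T
  commutator_compact : ∀ φ (g : G), IsCompactOperator (opCommutator (π.hom (c0Translate g φ)) T)
  commutator_vanishing : ∀ φ,
    Tendsto (fun g : G => opCommutator (π.hom (c0Translate g φ)) T) (cocompact G) (𝓝 0)
  cutoff_average : ∃ c : C₀(E, ℂ), IsCutoff μ c ∧ ∃ R : H →L[ℂ] H,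
    IsWeakIntegral μ (fun g => π.hom (c0Translate g c) * T * π.hom (c0Translate g c)) R ∧
    IsCompactOperator (R - T : H →L[ℂ] H)

/-- Proper `G`-equivariant Kasparov cycles. -/
def IsProperCycle (μ : Measure G) (E : Type*) [TopologicalSpace E] [MulAction G E]
    [ContinuousConstSMul G E] (S : GradedRep G H) (T : H →L[ℂ] H) : Prop :=
  IsKasparovCycle S T ∧ ∃ π : EquivariantRep S E, ProperConditions μ π T

/-- Property (γ) of the `G`-equivariant Kasparov cycle `(H, T)`. -/
structure HasPropertyGamma (μ : Measure G) (E : Type*) [TopologicalSpace E] [MulAction G E]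
    [ContinuousConstSMul G E] (S : GradedRep G H) (T : H →L[ℂ] H) : Prop where
  isKasparovCycle : IsKasparovCycle S T
  unit_on_compacts : IsUnitOnCompacts S T
  exists_rep : ∃ π : EquivariantRep S E, ProperConditions μ π T

end

/-! ### Unbounded operators -/

section

variable {H : Type*} [NormedAddCommGroup H] [InnerProductSpace ℂ H] [CompleteSpace H]

/-- Essentially self-adjoint: the closure is self-adjoint. -/
def IsEssentiallySelfAdjoint (D : H →ₗ.[ℂ] H) : Prop := IsSelfAdjoint D.closure

/-- The self-adjoint operator `A` has compact resolvent: `(A + i)⁻¹` is (everywhere defined and)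
compact. -/
def HasCompactResolvent (A : H →ₗ.[ℂ] H) : Prop :=
  ∃ R : H →L[ℂ] H, IsCompactOperator R ∧
    (∀ y, ∃ h : R y ∈ A.domain, A ⟨R y, h⟩ + Complex.I • R y = y) ∧
    (∀ x : A.domain, R (A x + Complex.I • (x : H)) = x)

/-- `T` is the bounded transform `A (1 + A²)^{-1/2}` of the self-adjoint operator `A`. Here `Q` is
`(1 + A²)^{-1/2}`, that is, the positive square root of the two-sided inverse of `1 + A²`. -/
def IsBoundedTransform (A : H →ₗ.[ℂ] H) (T : H →L[ℂ] H) : Prop :=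
  ∃ Q : H →L[ℂ] H, Q.IsPositive ∧
    (∀ y, ∃ (h : Q (Q y) ∈ A.domain) (h' : A ⟨Q (Q y), h⟩ ∈ A.domain),
      Q (Q y) + A ⟨A ⟨Q (Q y), h⟩, h'⟩ = y) ∧
    (∀ (x : A.domain) (h : A x ∈ A.domain), Q (Q (x + A ⟨A x, h⟩)) = x) ∧
    (∀ y, ∃ h : Q y ∈ A.domain, A ⟨Q y, h⟩ = T y)

variable {G : Type*} [Group G] [TopologicalSpace G]

/-- `D` is odd with respect to the grading. -/
def IsOddOperator (S : GradedRep G H) (D : H →ₗ.[ℂ] H) : Prop :=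
  ∀ x : D.domain, ∃ h : S.grading x ∈ D.domain, D ⟨S.grading x, h⟩ = -S.grading (D x)

/-- `D` is almost `G`-equivariant: `G` preserves the domain of `D`, and `g(D) - D` is bounded for
every `g`, where `g(D) = u_g D u_g*`. -/
def IsAlmostEquivariant (S : GradedRep G H) (D : H →ₗ.[ℂ] H) : Prop :=
  ∃ hdom : ∀ (g : G) (x : D.domain), S.rep g x ∈ D.domain,
    ∀ g : G, ∃ C : ℝ, ∀ x : D.domain,
      ‖S.rep g (D ⟨S.rep g⁻¹ x, hdom g⁻¹ x⟩) - D x‖ ≤ C * ‖(x : H)‖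

end

/-! ### Self-adjoint operators through `(1 + A²)⁻¹` and `A (1 + A²)⁻¹` -/

/-! Let A be the closure of D. The compact operators L = (1 + A²)⁻¹ and N = A (1 + A²)⁻¹ determine
the graph of A, so statements about A become algebra of bounded operators (`IsResolventPair`). With
Q = L^{1/2} the transform T = A Q satisfies 1 - T² = L, which is compact.

The other conditions concern commutators [a, T] for which [A, a] extends to a bounded operator M.
Write R±(s) = (A ± i√(1 + s²))⁻¹. The scalar identity ∫ x / (1 + s² x) ds = π√x shows that T x is
(2π)⁻¹ ∫ (R₊(s) + R₋(s)) x ds for x in the domain, whence [a, T] = (2π)⁻¹ ∫ (R₊ M R₊ + R₋ M R₋) ds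
(`commutator_eq_integral`). Since ‖R±(s)‖ ≤ (1 + s²)^{-1/2}, this converges in norm, and its
integrand is compact. Taking a = u_g gives almost equivariance of T; taking a = g(b) gives
compactness of [g(b), T], and density of B extends this to C₀(E).

For decay at infinity, M_g = b_g g(χ), and properness of the action makes g(χ) tend to 0 strongly.
The compact resolvent on the right turns this into norm convergence, and dominated convergence in s
finishes (`tendsto_commutator`).

For the cut-off condition, ∫ g(c)² dμ = 1 gives T - ∫ g(c) T g(c) dμ = ∫ g(c) [g(c), T] dμ. A weak
integral of compact operators need not be compact, so the integral formula is inserted and the order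
of integration exchanged. For fixed s the integral over G is a sum of terms Φ(R±) R±, where Φ(X) = ∫
g(c) X M_g dμ is bounded by a multiple of ‖X‖ because g(c) and g(χ) are square integrable families.
The right-hand factor is compact, and the integral over s converges in norm
(`exists_compact_average`). -/

section BoundedTransform

variable {H : Type*} [NormedAddCommGroup H] [InnerProductSpace ℂ H] [CompleteSpace H]

/-- `L = (1 + A²)⁻¹` and `N = A (1 + A²)⁻¹`, where `A` is the operator with graph `Γ`. -/
structure IsResolventPair (Γ : Submodule ℂ (H × H)) (L N : H →L[ℂ] H) : Prop where
  nonneg : 0 ≤ L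
  selfAdjoint : IsSelfAdjoint N
  mem_left : ∀ y, (L y, N y) ∈ Γ
  mem_right : ∀ y, (N y, y - L y) ∈ Γ
  eq_zero : ∀ {y}, (0, y) ∈ Γ → y = 0
  left_apply : ∀ {x y}, (x, y) ∈ Γ → L y = N x
  right_apply : ∀ {x y}, (x, y) ∈ Γ → N y = x - L x

namespace IsResolventPair

variable {Γ : Submodule ℂ (H × H)} {L N : H →L[ℂ] H}

theorem snd_unique (h : IsResolventPair Γ L N) {x y z : H} (hy : (x, y) ∈ Γ) (hz : (x, z) ∈ Γ) :
    y = z := by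
  exact sub_eq_zero.1 (h.eq_zero (by simpa using Γ.sub_mem hy hz))

/-- Under the two equations, (L x, N x) + (N y, y - L y) is exactly (x, y). The graph is thus cut
out by continuous equations, and in particular closed. -/
theorem mem_iff (h : IsResolventPair Γ L N) {x y : H} :
    (x, y) ∈ Γ ↔ L y = N x ∧ N y = x - L x := by
  refine ⟨fun hxy => ⟨h.left_apply hxy, h.right_apply hxy⟩, fun ⟨h1, h2⟩ => ?_⟩
  have := Γ.add_mem (h.mem_left x) (h.mem_right y)
  simpa [h1, h2] using this

theorem isClosed (h : IsResolventPair Γ L N) : IsClosed (Γ : Set (H × H)) := by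
  have : (Γ : Set (H × H)) = {p | L p.2 = N p.1} ∩ {p | N p.2 = p.1 - L p.1} := by
    ext ⟨x, y⟩; exact h.mem_iff
  rw [this]
  exact (isClosed_eq (by fun_prop) (by fun_prop)).inter (isClosed_eq (by fun_prop) (by fun_prop))

theorem commute (h : IsResolventPair Γ L N) : L * N = N * L := by
  ext y
  exact h.left_apply (h.mem_left y)

theorem mul_self (h : IsResolventPair Γ L N) : N * N = L - L * L := by
  ext y
  exact h.right_apply (h.mem_left y)

theorem isSelfAdjoint_left (h : IsResolventPair Γ L N) : IsSelfAdjoint L :=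
  IsSelfAdjoint.of_nonneg h.nonneg

theorem left_injective (h : IsResolventPair Γ L N) : Function.Injective L := by
  intro x y hxy
  have h0 : L (x - y) = 0 := by simp [hxy]
  have h1 := h.mem_left (x - y)
  have h2 := h.mem_right (x - y)
  rw [h0] at h1 h2
  have h3 := h.snd_unique h1 Γ.zero_mem
  rw [h3, sub_zero] at h2
  exact sub_eq_zero.1 (h.snd_unique h2 Γ.zero_mem)

/-- The graph of a self-adjoint operator is symmetric. -/
theorem inner_eq (h : IsResolventPair Γ L N) {x y x' y' : H} (hx : (x, y) ∈ Γ)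
    (hx' : (x', y') ∈ Γ) : inner ℂ y x' = inner ℂ x y' := by
  have e1 : x' = L x' + N y' := by rw [h.right_apply hx']; abel
  have e2 : x = L x + N y := by rw [h.right_apply hx]; abel
  have hL := h.isSelfAdjoint_left.isSymmetric
  have hN := h.selfAdjoint.isSymmetric
  calc inner ℂ y x' = inner ℂ (L y) x' + inner ℂ (N y) y' := by
        conv_lhs => rw [e1]
        rw [inner_add_right]
        congr 1
        · exact (hL _ _).symm
        · exact (hN _ _).symm
    _ = inner ℂ (N x) x' + inner ℂ (x - L x) y' := by
        rw [h.left_apply hx, h.right_apply hx]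
    _ = inner ℂ x (N x') + (inner ℂ x y' - inner ℂ x (L y')) := by
        rw [inner_sub_left]
        congr 1
        · exact hN _ _
        · congr 1
          exact hL _ _
    _ = inner ℂ x y' := by rw [h.left_apply hx']; ring

end IsResolventPair

omit [CompleteSpace H] in
theorem LinearPMap.mem_graph_of_apply_eq {A : H →ₗ.[ℂ] H} {x y : H} {h : x ∈ A.domain}
    (hy : A ⟨x, h⟩ = y) : (x, y) ∈ A.graph :=
  A.mem_graph_iff.2 ⟨⟨x, h⟩, rfl, hy⟩

omit [CompleteSpace H] in
theorem LinearPMap.exists_apply_eq_of_mem_graph {A : H →ₗ.[ℂ] H} {x y : H}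
    (hy : (x, y) ∈ A.graph) : ∃ h : x ∈ A.domain, A ⟨x, h⟩ = y := by
  obtain ⟨⟨z, hz⟩, rfl, h⟩ := A.mem_graph_iff.1 hy
  exact ⟨hz, h⟩

theorem IsSelfAdjoint.mem_graph_of_inner {A : H →ₗ.[ℂ] H} (hA : IsSelfAdjoint A) {x y : H}
    (h : ∀ x' y', (x', y') ∈ A.graph → inner ℂ y x' = inner ℂ x y') : (x, y) ∈ A.graph := by
  have hd : ∀ z : A.domain, inner ℂ y (z : H) = inner ℂ x (A z) := fun z => h _ _ (A.mem_graph z)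
  have hx : x ∈ A.adjoint.domain := LinearPMap.mem_adjoint_domain_of_exists _ ⟨y, hd⟩
  have hy : A.adjoint ⟨x, hx⟩ = y := LinearPMap.adjoint_apply_eq hA.dense_domain ⟨x, hx⟩ hd
  have hm := LinearPMap.mem_graph_of_apply_eq hy
  rwa [LinearPMap.isSelfAdjoint_def.1 hA] at hm

theorem IsSelfAdjoint.inner_graph {A : H →ₗ.[ℂ] H} (hA : IsSelfAdjoint A) {x y x' y' : H}
    (h : (x, y) ∈ A.graph) (h' : (x', y') ∈ A.graph) : inner ℂ y x' = inner ℂ x y' := by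
  rw [← LinearPMap.isSelfAdjoint_def.1 hA] at h
  obtain ⟨hx, rfl⟩ := LinearPMap.exists_apply_eq_of_mem_graph h
  obtain ⟨hx', rfl⟩ := LinearPMap.exists_apply_eq_of_mem_graph h'
  exact LinearPMap.adjoint_isFormalAdjoint hA.dense_domain ⟨x, hx⟩ ⟨x', hx'⟩

open ContinuousLinearMap in
-- With R = (A + i)⁻¹ and R* = (A - i)⁻¹, take L = R R* and N = (R + R*)/2. The resolvent identity
-- R* - R = 2i R R* yields all the relations, and also the compactness of R*.
theorem HasCompactResolvent.exists_isResolventPair {A : H →ₗ.[ℂ] H} (hA : IsSelfAdjoint A)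
    (h : HasCompactResolvent A) : ∃ L N : H →L[ℂ] H, IsResolventPair A.graph L N ∧
      IsCompactOperator L ∧ IsCompactOperator N := by
  obtain ⟨R, hRc, hR1, hR2⟩ := h
  have r1 : ∀ y, (R y, y - Complex.I • R y) ∈ A.graph := fun y => by
    obtain ⟨hd, e⟩ := hR1 y
    exact LinearPMap.mem_graph_of_apply_eq (eq_sub_of_add_eq e)
  have r2 : ∀ {x y}, (x, y) ∈ A.graph → R (y + Complex.I • x) = x := fun {x y} hxy => by
    obtain ⟨hx, rfl⟩ := LinearPMap.exists_apply_eq_of_mem_graph hxy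
    exact hR2 ⟨x, hx⟩
  have s1 : ∀ y, (adjoint R y, y + Complex.I • adjoint R y) ∈ A.graph := fun y => by
    refine hA.mem_graph_of_inner fun x' y' hx' => ?_
    rw [adjoint_inner_left, inner_add_left, inner_smul_left, adjoint_inner_left]
    have e := r2 hx'
    rw [map_add, map_smul] at e
    rw [← map_smul, ← eq_sub_iff_add_eq] at e
    rw [e, inner_sub_right, map_smul, inner_smul_right]
    simp [sub_eq_add_neg]
  have s2 : ∀ {x y}, (x, y) ∈ A.graph → adjoint R (y - Complex.I • x) = x := fun {x y} hxy => by
    refine ext_inner_right ℂ fun z => ?_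
    rw [adjoint_inner_left, inner_sub_left, inner_smul_left, hA.inner_graph hxy (r1 z),
      inner_sub_right, inner_smul_right]
    simp
  -- `R* = R + 2 i R R*`
  have e1 : ∀ y, adjoint R y = R y + (2 * Complex.I) • R (adjoint R y) := fun y => by
    have := r2 (s1 y)
    simp only [map_add, map_smul] at this
    linear_combination (norm := module) (-1 : ℂ) • this
  have e2 : ∀ y, R (adjoint R y) = (-(Complex.I / 2)) • (adjoint R y - R y) := fun y => by
    have h1 : adjoint R y - R y = (2 * Complex.I) • R (adjoint R y) := sub_eq_iff_eq_add'.2 (e1 y)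
    have h2 : -(Complex.I / 2) * (2 * Complex.I) = 1 := by linear_combination -Complex.I_mul_I
    rw [h1, smul_smul, h2, one_smul]
  have e3 : ∀ y, Complex.I • R (adjoint R y) = (2⁻¹ : ℂ) • (adjoint R y - R y) := fun y => by
    linear_combination (norm := module) (-2⁻¹ : ℂ) • e1 y
  have hRa : IsCompactOperator (adjoint R) := by
    have : (adjoint R : H →L[ℂ] H) = R + (2 * Complex.I) • (R ∘L adjoint R) := by
      ext y; exact e1 y
    rw [this]
    exact hRc.add ((hRc.comp_clm (adjoint R)).smul (2 * Complex.I))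
  refine ⟨R ∘L adjoint R, (2⁻¹ : ℂ) • (R + adjoint R), ⟨?_, ?_, ?_, ?_, ?_, ?_, ?_⟩,
    hRc.comp_clm _, (hRc.add hRa).smul _⟩
  · rw [ContinuousLinearMap.nonneg_iff_isPositive]
    exact ContinuousLinearMap.isPositive_self_comp_adjoint R
  · rw [ContinuousLinearMap.isSelfAdjoint_iff']
    simp only [map_smulₛₗ, map_add, adjoint_adjoint, map_inv₀, map_ofNat, add_comm]
  · intro y
    convert r1 (adjoint R y) using 2
    · rfl
    · rw [e3]
      simp only [_root_.smul_apply, _root_.add_apply]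
      module
  · intro y
    convert A.graph.smul_mem (2⁻¹ : ℂ) (A.graph.add_mem (r1 y) (s1 y)) using 1
    ext
    · simp
    · simp only [coe_comp, Function.comp_apply, Prod.smul_mk, Prod.mk_add_mk, e2]
      module
  · intro y hy
    obtain ⟨h0, rfl⟩ := LinearPMap.exists_apply_eq_of_mem_graph hy
    exact A.map_zero
  · intro x y hxy
    have h2 := s2 hxy
    rw [map_sub, map_smul, sub_eq_iff_eq_add] at h2
    simp only [coe_comp, Function.comp_apply, h2, map_add, map_smul, e3, _root_.smul_apply,
      _root_.add_apply]
    module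
  · intro x y hxy
    have h1 := r2 hxy
    have h2 := s2 hxy
    rw [map_sub, map_smul, sub_eq_iff_eq_add] at h2
    rw [map_add, map_smul, ← eq_sub_iff_add_eq] at h1
    simp only [coe_comp, Function.comp_apply, h1, h2, e2, _root_.smul_apply,
      _root_.add_apply]
    module

end BoundedTransform

/-! ### The bounded transform: existence, uniqueness and algebra -/

section BoundedTransform

variable {H : Type*} [NormedAddCommGroup H] [InnerProductSpace ℂ H] [CompleteSpace H]

theorem ContinuousLinearMap.denseRange_of_isSelfAdjoint {Q : H →L[ℂ] H} (hQ : IsSelfAdjoint Q)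
    (hinj : Function.Injective Q) : DenseRange Q := by
  have h1 : (LinearMap.range (Q : H →ₗ[ℂ] H))ᗮ = ⊥ := by
    rw [ContinuousLinearMap.orthogonal_range, ContinuousLinearMap.isSelfAdjoint_iff'.1 hQ]
    exact LinearMap.ker_eq_bot.2 hinj
  have h2 := (Submodule.dense_iff_topologicalClosure_eq_top
    (s := LinearMap.range (Q : H →ₗ[ℂ] H))).2 ((Submodule.topologicalClosure_eq_top_iff).2 h1)
  exact h2

/-- `Q = (1 + A²)^{-1/2}` and `T = A Q`, where `A` is the operator with graph `Γ`. -/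
structure IsTransformPair (Γ : Submodule ℂ (H × H)) (L Q T : H →L[ℂ] H) : Prop where
  nonneg : 0 ≤ Q
  mul_self : Q * Q = L
  mem : ∀ y, (Q y, T y) ∈ Γ

namespace IsTransformPair

variable {Γ : Submodule ℂ (H × H)} {L N Q T : H →L[ℂ] H}

theorem eq_sqrt (hT : IsTransformPair Γ L Q T) : Q = CFC.sqrt L :=
  (CFC.sqrt_unique hT.mul_self hT.nonneg).symm

theorem isSelfAdjoint_left (hT : IsTransformPair Γ L Q T) : IsSelfAdjoint Q :=
  IsSelfAdjoint.of_nonneg hT.nonneg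

theorem left_injective (hT : IsTransformPair Γ L Q T) (h : IsResolventPair Γ L N) :
    Function.Injective Q := by
  intro x y hxy
  apply h.left_injective
  rw [← hT.mul_self, mul_apply_eq_comp, hxy]
  rfl

theorem mul_left_cancel (hT : IsTransformPair Γ L Q T) (h : IsResolventPair Γ L N)
    {X Y : H →L[ℂ] H} (hXY : Q * X = Q * Y) : X = Y := by
  ext y
  exact hT.left_injective h (DFunLike.congr_fun hXY y)

/-- An operator which commutes with `L` commutes with `Q`. -/
theorem commute_of_commute (hT : IsTransformPair Γ L Q T) {X : H →L[ℂ] H} (hX : Commute L X)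
    (hL : 0 ≤ L) : Commute Q X := by
  rw [hT.eq_sqrt, CFC.sqrt_eq_real_sqrt L hL]
  exact (hX.cfcₙ_real _)

theorem mul_left_eq (hT : IsTransformPair Γ L Q T) (h : IsResolventPair Γ L N) : T * Q = N := by
  ext y
  refine h.snd_unique (hT.mem (Q y)) ?_
  have : Q (Q y) = L y := DFunLike.congr_fun hT.mul_self y
  rw [this]
  exact h.mem_left y

/-- Apply Q once more: Q² T = L T = N Q, because (Q y, T y) lies in the graph, and N Q = Q N since Q
is a function of L. Injectivity of Q then removes the extra factor. -/
theorem left_mul_eq (hT : IsTransformPair Γ L Q T) (h : IsResolventPair Γ L N) : Q * T = N := by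
  have hc := hT.commute_of_commute h.commute h.nonneg
  refine hT.mul_left_cancel h ?_
  rw [← mul_assoc, hT.mul_self, hc.eq]
  ext y
  exact h.left_apply (hT.mem y)

theorem isSelfAdjoint (hT : IsTransformPair Γ L Q T) (h : IsResolventPair Γ L N) :
    IsSelfAdjoint T := by
  refine hT.mul_left_cancel h ?_
  rw [hT.left_mul_eq h, ← h.selfAdjoint.star_eq, ← hT.mul_left_eq h, star_mul,
    hT.isSelfAdjoint_left.star_eq]

theorem one_sub_mul_self (hT : IsTransformPair Γ L Q T) (h : IsResolventPair Γ L N) :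
    1 - T * T = L := by
  have h1 : T * T * Q = (1 - L) * Q := by
    refine hT.mul_left_cancel h ?_
    calc Q * (T * T * Q) = (Q * T) * (T * Q) := by noncomm_ring
      _ = L - L * L := by rw [hT.left_mul_eq h, hT.mul_left_eq h, h.mul_self]
      _ = Q * ((1 - L) * Q) := by simp only [← hT.mul_self]; noncomm_ring
  -- Taking adjoints moves Q to the left, where it can be cancelled by injectivity.
  have h2 : Q * (T * T) = Q * (1 - L) := by
    have := congrArg star h1
    simpa only [star_mul, star_sub, star_one, (hT.isSelfAdjoint h).star_eq,
      hT.isSelfAdjoint_left.star_eq, h.isSelfAdjoint_left.star_eq] using this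
  rw [hT.mul_left_cancel h h2]
  abel

theorem apply_fst (hT : IsTransformPair Γ L Q T) (h : IsResolventPair Γ L N) {x y : H}
    (hxy : (x, y) ∈ Γ) : T x = Q y := by
  refine hT.left_injective h ?_
  have h1 : Q (T x) = N x := DFunLike.congr_fun (hT.left_mul_eq h) x
  have h2 : Q (Q y) = L y := DFunLike.congr_fun hT.mul_self y
  rw [h1, h2, h.left_apply hxy]

theorem unique {Q' T' : H →L[ℂ] H} (hT : IsTransformPair Γ L Q T) (hT' : IsTransformPair Γ L Q' T')
    (h : IsResolventPair Γ L N) : T = T' := by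
  have hQ : Q = Q' := hT.eq_sqrt.trans hT'.eq_sqrt.symm
  subst hQ
  ext y
  exact h.snd_unique (hT.mem y) (hT'.mem y)

/-- If `A` anticommutes with the involution `U`, then so does its bounded transform. -/
theorem anticommute (hT : IsTransformPair Γ L Q T) (h : IsResolventPair Γ L N) {U : H →L[ℂ] H}
    (hU : ∀ {x y}, (x, y) ∈ Γ → (U x, -U y) ∈ Γ) : T * U = -(U * T) := by
  have e1 : ∀ y, (U (L y), -U (N y)) ∈ Γ := fun y => hU (h.mem_left y)
  have e2 : ∀ y, (-U (N y), U (y - L y)) ∈ Γ := fun y => by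
    have := hU (h.mem_right y)
    simpa using Γ.neg_mem this
  have hLU : ∀ y, L (U y) = U (L y) := fun y => by
    have h1 := h.right_apply (e1 y)
    have h2 := h.left_apply (e2 y)
    rw [h1, map_sub, map_sub] at h2
    exact sub_left_injective h2
  have hNU : ∀ y, N (U y) = -U (N y) := fun y => by
    have h1 := h.left_apply (e1 y)
    have h2 := h.right_apply (e2 y)
    rw [map_sub, map_sub, map_neg, sub_neg_eq_add, ← h1, map_neg, sub_neg_eq_add] at h2
    exact add_right_cancel h2
  have hQU : Commute Q U := hT.commute_of_commute (by ext y; exact hLU y) h.nonneg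
  refine hT.mul_left_cancel h ?_
  rw [← mul_assoc, hT.left_mul_eq h, mul_neg, ← mul_assoc, hQU.eq, mul_assoc, hT.left_mul_eq h]
  ext y
  exact hNU y

end IsTransformPair

/-- On the dense range of Q, T must send Q z to N z. This is contractive, since ‖N z‖² = ‖Q z‖² - ‖L
z‖² by N² = L - L², and closedness of the graph keeps the limit in it. -/
theorem IsResolventPair.exists_isTransformPair {Γ : Submodule ℂ (H × H)} {L N : H →L[ℂ] H}
    (h : IsResolventPair Γ L N) : ∃ Q T : H →L[ℂ] H, IsTransformPair Γ L Q T := by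
  set Q := CFC.sqrt L with hQdef
  have hQ : 0 ≤ Q := CFC.sqrt_nonneg L
  have hQQ : Q * Q = L := CFC.sqrt_mul_sqrt_self L h.nonneg
  have hQs : IsSelfAdjoint Q := IsSelfAdjoint.of_nonneg hQ
  have hQa : ∀ y, Q (Q y) = L y := fun y => DFunLike.congr_fun hQQ y
  have hinj : Function.Injective Q := fun x y hxy => h.left_injective (by rw [← hQa, ← hQa, hxy])
  have hd : DenseRange Q := ContinuousLinearMap.denseRange_of_isSelfAdjoint hQs hinj
  have hle : ∀ z, ‖N z‖ ≤ ‖Q z‖ := fun z => by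
    have h1 : inner ℂ (N z) (N z) = inner ℂ (Q z) (Q z) - inner ℂ (L z) (L z) := by
      have a1 : inner ℂ (N z) (N z) = inner ℂ z (N (N z)) := h.selfAdjoint.isSymmetric _ _
      have a2 : inner ℂ (Q z) (Q z) = inner ℂ z (Q (Q z)) := hQs.isSymmetric _ _
      have a3 : inner ℂ (L z) (L z) = inner ℂ z (L (L z)) := h.isSelfAdjoint_left.isSymmetric _ _
      have a4 : N (N z) = L z - L (L z) := DFunLike.congr_fun h.mul_self z
      rw [a1, a2, a3, a4, hQa, inner_sub_right]
    simp only [inner_self_eq_norm_sq_to_K] at h1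
    have h2 : ‖N z‖ ^ 2 = ‖Q z‖ ^ 2 - ‖L z‖ ^ 2 := by exact_mod_cast h1
    exact le_of_sq_le_sq (by nlinarith [sq_nonneg ‖L z‖]) (norm_nonneg _)
  have hex : ∀ y, ∃ t, (Q y, t) ∈ Γ ∧ ‖t‖ ≤ ‖y‖ := fun y => by
    obtain ⟨w, hw, hlim⟩ := mem_closure_iff_seq_limit.1 (hd y)
    choose z hz using hw
    have hz' : Tendsto (fun n => Q (z n)) atTop (𝓝 y) := by simpa only [hz] using hlim
    have hc : CauchySeq fun n => N (z n) := by
      refine Metric.cauchySeq_iff.2 fun ε hε => ?_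
      obtain ⟨k, hk⟩ := Metric.cauchySeq_iff.1 hz'.cauchySeq ε hε
      refine ⟨k, fun m hm n hn => lt_of_le_of_lt ?_ (hk m hm n hn)⟩
      rw [dist_eq_norm, dist_eq_norm, ← map_sub, ← map_sub]
      exact hle _
    obtain ⟨t, ht⟩ := cauchySeq_tendsto_of_complete hc
    refine ⟨t, ?_, le_of_tendsto_of_tendsto' ht.norm hz'.norm fun n => hle _⟩
    refine h.isClosed.mem_of_tendsto
      (((Q.continuous.tendsto y).comp hz').prodMk_nhds ht) (Eventually.of_forall fun n => ?_)
    simp only [Function.comp_apply, hQa]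
    exact h.mem_left (z n)
  choose t ht htn using hex
  refine ⟨Q, LinearMap.mkContinuous
    { toFun := t
      map_add' := fun x y => h.snd_unique (ht (x + y)) (by simpa using Γ.add_mem (ht x) (ht y))
      map_smul' := fun c x => h.snd_unique (ht (c • x)) (by simpa using Γ.smul_mem c (ht x)) } 1
      (fun x => by simpa using htn x), hQ, hQQ, ht⟩

theorem IsBoundedTransform.exists_isTransformPair {A : H →ₗ.[ℂ] H} {L N T : H →L[ℂ] H}
    (h : IsResolventPair A.graph L N) (hT : IsBoundedTransform A T) :
    ∃ Q, IsTransformPair A.graph L Q T := by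
  obtain ⟨Q, hQ, h1, -, h3⟩ := hT
  refine ⟨Q, (ContinuousLinearMap.nonneg_iff_isPositive _).2 hQ, ?_, fun y => ?_⟩
  · ext y
    obtain ⟨hd, hd', e⟩ := h1 y
    -- Q² is a right inverse of 1 + A² and L is a left inverse, so they agree.
    have m1 := LinearPMap.mem_graph_of_apply_eq (A := A) (h := hd) rfl
    have m2 := LinearPMap.mem_graph_of_apply_eq (A := A) (h := hd') (eq_sub_of_add_eq' e)
    have h4 := h.left_apply m2
    rw [h.right_apply m1, map_sub] at h4
    exact (sub_left_injective h4).symm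
  · obtain ⟨hd, e⟩ := h3 y
    exact LinearPMap.mem_graph_of_apply_eq e

theorem IsTransformPair.isBoundedTransform {A : H →ₗ.[ℂ] H} {L N Q T : H →L[ℂ] H}
    (hT : IsTransformPair A.graph L Q T) (h : IsResolventPair A.graph L N) :
    IsBoundedTransform A T := by
  have hQa : ∀ y, Q (Q y) = L y := fun y => DFunLike.congr_fun hT.mul_self y
  refine ⟨Q, (ContinuousLinearMap.nonneg_iff_isPositive _).1 hT.nonneg, fun y => ?_,
    fun x hx => ?_, fun y => LinearPMap.exists_apply_eq_of_mem_graph (hT.mem y)⟩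
  · rw [hQa]
    obtain ⟨h1, e1⟩ := LinearPMap.exists_apply_eq_of_mem_graph (h.mem_left y)
    obtain ⟨h2, e2⟩ := LinearPMap.exists_apply_eq_of_mem_graph (h.mem_right y)
    refine ⟨h1, e1 ▸ h2, ?_⟩
    simp only [e1, e2]
    abel
  · have m1 := A.mem_graph x
    have m2 := A.mem_graph ⟨A x, hx⟩
    rw [hQa, map_add, h.left_apply m2, h.right_apply m1]
    abel

end BoundedTransform

/-! ### The integral formula for the square root of `L` -/

section Resolvent

variable {H : Type*} [NormedAddCommGroup H] [InnerProductSpace ℂ H] [CompleteSpace H]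

/-- `(1 + s² L)⁻¹` for a positive operator `L`. -/
noncomputable def invOneAddSqMul (L : H →L[ℂ] H) (s : ℝ) : H →L[ℂ] H :=
  cfc (fun x : ℝ => (1 + s ^ 2 * x)⁻¹) L

theorem one_add_sq_mul_pos {s x : ℝ} (hx : 0 ≤ x) : 0 < 1 + s ^ 2 * x := by positivity

theorem continuousOn_inv_one_add_sq_mul {L : H →L[ℂ] H} (hL : 0 ≤ L) (s : ℝ) :
    ContinuousOn (fun x : ℝ => (1 + s ^ 2 * x)⁻¹) (spectrum ℝ L) :=
  ContinuousOn.inv₀ (by fun_prop) fun _ hx =>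
    (one_add_sq_mul_pos (spectrum_nonneg_of_nonneg hL hx)).ne'

theorem commute_invOneAddSqMul {L X : H →L[ℂ] H} (hX : Commute L X) (s : ℝ) :
    Commute (invOneAddSqMul L s) X :=
  hX.cfc_real _

theorem one_add_mul_invOneAddSqMul {L : H →L[ℂ] H} (hL : 0 ≤ L) (s : ℝ) :
    (1 + ((s : ℂ) ^ 2) • L) * invOneAddSqMul L s = 1 := by
  have hsa : IsSelfAdjoint L := IsSelfAdjoint.of_nonneg hL
  have h1 : cfc (fun x : ℝ => (1 + s ^ 2 * x)) L = 1 + ((s : ℂ) ^ 2) • L := by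
    rw [cfc_const_add (1 : ℝ) (fun x => s ^ 2 * x) L, cfc_const_mul_id (s ^ 2) L, map_one]
    rw [RCLike.real_smul_eq_coe_smul (K := ℂ)]
    simp
  rw [← h1, invOneAddSqMul, ← cfc_mul _ _ L (by fun_prop) (continuousOn_inv_one_add_sq_mul hL s),
    ← cfc_one ℝ L]
  refine cfc_congr fun x hx => ?_
  exact mul_inv_cancel₀ (one_add_sq_mul_pos (spectrum_nonneg_of_nonneg hL hx)).ne'

theorem norm_invOneAddSqMul_le {L : H →L[ℂ] H} (hL : 0 ≤ L) (s : ℝ) :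
    ‖invOneAddSqMul L s‖ ≤ 1 := by
  refine norm_cfc_le zero_le_one fun x hx => ?_
  have h := spectrum_nonneg_of_nonneg hL hx
  rw [Real.norm_of_nonneg (inv_nonneg.2 (one_add_sq_mul_pos h).le)]
  refine inv_le_one_of_one_le₀ ?_
  have : 0 ≤ s ^ 2 * x := by positivity
  linarith

theorem continuous_invOneAddSqMul {L : H →L[ℂ] H} (hL : 0 ≤ L) :
    Continuous (invOneAddSqMul L) := by
  -- The resolvent identity; the factor t² - s² gives norm continuity.
  have key : ∀ s t : ℝ, invOneAddSqMul L s - invOneAddSqMul L t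
      = ((t : ℂ) ^ 2 - (s : ℂ) ^ 2) • (invOneAddSqMul L s * L * invOneAddSqMul L t) := by
    intro s t
    have hs := one_add_mul_invOneAddSqMul hL s
    have ht := one_add_mul_invOneAddSqMul hL t
    have hc := (commute_invOneAddSqMul (Commute.refl L) s).eq
    have hs' : invOneAddSqMul L s * (1 + ((s : ℂ) ^ 2) • L) = 1 := by
      refine Eq.trans ?_ hs
      simp [mul_add, add_mul, hc]
    calc invOneAddSqMul L s - invOneAddSqMul L t
        = invOneAddSqMul L s * ((1 + ((t : ℂ) ^ 2) • L) * invOneAddSqMul L t)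
          - (invOneAddSqMul L s * (1 + ((s : ℂ) ^ 2) • L)) * invOneAddSqMul L t := by
            rw [ht, hs', mul_one, one_mul]
      _ = _ := by
        simp only [mul_add, add_mul, one_mul, mul_one, smul_mul_assoc, mul_smul_comm, sub_smul,
          mul_assoc]
        abel
  refine continuous_iff_continuousAt.2 fun t => ?_
  rw [ContinuousAt, tendsto_iff_norm_sub_tendsto_zero]
  refine squeeze_zero (fun _ => norm_nonneg _)
    (g := fun s : ℝ => ‖((t : ℂ) ^ 2 - (s : ℂ) ^ 2)‖ * ‖L‖) (fun s => ?_) ?_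
  · rw [key, norm_smul]
    refine mul_le_mul_of_nonneg_left ?_ (norm_nonneg _)
    calc _ ≤ ‖invOneAddSqMul L s‖ * ‖L‖ * ‖invOneAddSqMul L t‖ :=
          (norm_mul_le _ _).trans (mul_le_mul_of_nonneg_right (norm_mul_le _ _) (norm_nonneg _))
      _ ≤ 1 * ‖L‖ * 1 := by
          gcongr <;> exact norm_invOneAddSqMul_le hL _
      _ = ‖L‖ := by ring
  · have : Continuous fun s : ℝ => ‖((t : ℂ) ^ 2 - (s : ℂ) ^ 2)‖ * ‖L‖ := by fun_prop
    simpa using this.tendsto t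

theorem integral_inv_one_add_sq_mul {x : ℝ} (hx : 0 ≤ x) :
    ∫ s : ℝ, x * (1 + s ^ 2 * x)⁻¹ = Real.pi * √x := by
  rcases hx.eq_or_lt with rfl | hx
  · simp
  have hsq : 0 < √x := Real.sqrt_pos.2 hx
  have h1 : ∀ s : ℝ, x * (1 + s ^ 2 * x)⁻¹ = x * (1 + (√x * s) ^ 2)⁻¹ := fun s => by
    rw [mul_pow, Real.sq_sqrt hx.le, mul_comm x (s ^ 2)]
  simp_rw [h1, integral_const_mul]
  rw [Measure.integral_comp_mul_left (fun y => (1 + y ^ 2)⁻¹), integral_univ_inv_one_add_sq,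
    abs_of_pos (inv_pos.2 hsq), smul_eq_mul]
  have := Real.mul_self_sqrt hx.le
  field_simp
  nlinarith

/-- In x (1 + s²) the first term is at most C and the second is at most 1 · s² x; hence the constant
max C 1. The bound is uniform in x ≤ C, as needed to integrate the functional calculus. -/
theorem mul_inv_le_mul_inv {x C s : ℝ} (hx : 0 ≤ x) (hC : x ≤ C) :
    x * (1 + s ^ 2 * x)⁻¹ ≤ max C 1 * (1 + s ^ 2)⁻¹ := by
  rw [← div_eq_mul_inv, ← div_eq_mul_inv, div_le_div_iff₀ (one_add_sq_mul_pos hx) (by positivity)]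
  have h1 : x ≤ max C 1 := hC.trans (le_max_left _ _)
  have h2 : 1 ≤ max C 1 := le_max_right _ _
  have h3 : 0 ≤ s ^ 2 * x := by positivity
  nlinarith

/-- In terms of A the integrand is (1 + s² + A²)⁻¹. The scalar identity ∫ x (1 + s² x)⁻¹ ds = π√x is
integrated through the functional calculus. -/
theorem sqrt_eq_integral {L : H →L[ℂ] H} (hL : 0 ≤ L) :
    Integrable (fun s : ℝ => L * invOneAddSqMul L s) ∧
    Real.pi • CFC.sqrt L = ∫ s : ℝ, L * invOneAddSqMul L s := by
  have hsa : IsSelfAdjoint L := IsSelfAdjoint.of_nonneg hL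
  have h1 : ∀ s : ℝ, L * invOneAddSqMul L s = cfc (fun x : ℝ => x * (1 + s ^ 2 * x)⁻¹) L :=
    fun s => by
      rw [cfc_mul _ _ L (by fun_prop) (continuousOn_inv_one_add_sq_mul hL s), cfc_id' ℝ L]
      rfl
  have hc : ContinuousOn (Function.uncurry fun (s x : ℝ) => x * (1 + s ^ 2 * x)⁻¹)
      (Set.univ ×ˢ spectrum ℝ L) := by
    refine ContinuousOn.mul (by fun_prop) (ContinuousOn.inv₀ (by fun_prop) fun p hp => ?_)
    exact (one_add_sq_mul_pos (spectrum_nonneg_of_nonneg hL hp.2)).ne'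
  -- The factor ‖1‖ remains because H may be zero.
  have hb : ∀ᵐ s : ℝ, ∀ x ∈ spectrum ℝ L,
      ‖x * (1 + s ^ 2 * x)⁻¹‖ ≤ max (‖L‖ * ‖(1 : H →L[ℂ] H)‖) 1 * (1 + s ^ 2)⁻¹ :=
    Eventually.of_forall fun s x hx => by
      have h := spectrum_nonneg_of_nonneg hL hx
      rw [Real.norm_of_nonneg (mul_nonneg h (inv_nonneg.2 (one_add_sq_mul_pos h).le))]
      refine mul_inv_le_mul_inv h ((le_abs_self x).trans ?_)
      exact spectrum.norm_le_norm_mul_of_mem hx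
  have hi : HasFiniteIntegral (fun s : ℝ => max (‖L‖ * ‖(1 : H →L[ℂ] H)‖) 1 * (1 + s ^ 2)⁻¹) :=
    (integrable_inv_one_add_sq.const_mul _).2
  simp_rw [h1]
  refine ⟨integrable_cfc _ _ L hc hb hi, ?_⟩
  rw [← cfc_integral _ _ L hc hb hi, CFC.sqrt_eq_real_sqrt L hL, cfcₙ_eq_cfc,
    ← cfc_const_mul Real.pi Real.sqrt L]
  exact cfc_congr fun x hx => (integral_inv_one_add_sq_mul (spectrum_nonneg_of_nonneg hL hx)).symm

end Resolvent

/-! ### The integral formula for commutators with the bounded transform -/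

section Commutator

variable {H : Type*} [NormedAddCommGroup H] [InnerProductSpace ℂ H] [CompleteSpace H]

/-- The resolvent `(A + i ε √(1 + s²))⁻¹`, for `ε = ± 1`. -/
noncomputable def resolventAt (L N : H →L[ℂ] H) (ε s : ℝ) : H →L[ℂ] H :=
  (N - (Complex.I * (ε * √(1 + s ^ 2) : ℝ)) • L) * invOneAddSqMul L s

namespace IsResolventPair

variable {Γ : Submodule ℂ (H × H)} {L N : H →L[ℂ] H}

theorem commute_inv (h : IsResolventPair Γ L N) (s : ℝ) : Commute (invOneAddSqMul L s) N :=
  commute_invOneAddSqMul h.commute s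

theorem I_mul_sqrt_sq {ε : ℝ} (hε : ε ^ 2 = 1) (s : ℝ) :
    (Complex.I * (ε * √(1 + s ^ 2) : ℝ)) * (Complex.I * (ε * √(1 + s ^ 2) : ℝ))
      = -(1 + (s : ℂ) ^ 2) := by
  have h : (ε * √(1 + s ^ 2)) * (ε * √(1 + s ^ 2)) = 1 + s ^ 2 := by
    have := Real.mul_self_sqrt (show 0 ≤ 1 + s ^ 2 by positivity)
    calc _ = ε ^ 2 * (√(1 + s ^ 2) * √(1 + s ^ 2)) := by ring
      _ = _ := by rw [hε, this, one_mul]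
  calc _ = (Complex.I * Complex.I) * (((ε * √(1 + s ^ 2)) * (ε * √(1 + s ^ 2)) : ℝ) : ℂ) := by
        push_cast; ring
    _ = _ := by rw [h, Complex.I_mul_I]; push_cast; ring

theorem resolventAt_mem (h : IsResolventPair Γ L N) {ε : ℝ} (hε : ε ^ 2 = 1) (s : ℝ) (y : H) :
    (resolventAt L N ε s y,
      y - (Complex.I * (ε * √(1 + s ^ 2) : ℝ)) • resolventAt L N ε s y) ∈ Γ := by
  have hτ := I_mul_sqrt_sq hε s
  set τ : ℂ := Complex.I * (ε * √(1 + s ^ 2) : ℝ) with hτd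
  set z := invOneAddSqMul L s y with hz
  have hy : y = z + ((s : ℂ) ^ 2) • L z := by
    have := DFunLike.congr_fun (one_add_mul_invOneAddSqMul h.nonneg s) y
    simpa using this.symm
  have hR : resolventAt L N ε s y = N z - τ • L z := by
    simp [resolventAt, hz, hτd]
  have := Γ.sub_mem (h.mem_right z) (Γ.smul_mem τ (h.mem_left z))
  rw [hR]
  convert this using 1
  ext
  · rfl
  · conv_lhs => rw [hy]
    change z + ((s : ℂ) ^ 2) • L z - τ • (N z - τ • L z) = z - L z - τ • N z
    rw [smul_sub, smul_smul, hτ]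
    module

theorem resolventAt_apply (h : IsResolventPair Γ L N) {ε : ℝ} (hε : ε ^ 2 = 1) (s : ℝ) {x y : H}
    (hxy : (x, y) ∈ Γ) :
    resolventAt L N ε s (y + (Complex.I * (ε * √(1 + s ^ 2) : ℝ)) • x) = x := by
  have hτ := I_mul_sqrt_sq hε s
  set τ : ℂ := Complex.I * (ε * √(1 + s ^ 2) : ℝ) with hτd
  have hJ : resolventAt L N ε s = invOneAddSqMul L s * (N - τ • L) := by
    have h1 := (h.commute_inv s).eq
    have h2 := (commute_invOneAddSqMul (Commute.refl L) s).eq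
    rw [resolventAt, sub_mul, mul_sub, h1, smul_mul_assoc, mul_smul_comm, h2]
  have h1 : (N - τ • L) (y + τ • x) = (1 + ((s : ℂ) ^ 2) • L) x := by
    have e : (N - τ • L) (y + τ • x) = (N y + τ • N x) - (τ • L y + (τ * τ) • L x) := by
      simp only [_root_.sub_apply, _root_.smul_apply, map_add, map_smul, mul_smul]
      module
    rw [e, hτ, h.left_apply hxy, h.right_apply hxy]
    change _ = x + ((s : ℂ) ^ 2) • L x
    module
  have h2 : invOneAddSqMul L s * (1 + ((s : ℂ) ^ 2) • L) = 1 := by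
    have hc := (commute_invOneAddSqMul (Commute.refl L) s).eq
    refine Eq.trans ?_ (one_add_mul_invOneAddSqMul h.nonneg s)
    simp [mul_add, add_mul, hc]
  rw [hJ, mul_apply_eq_comp, h1, ← mul_apply_eq_comp, h2]
  rfl

/-- If y = A x + iτx, symmetry makes ⟨A x, x⟩ real, so the two terms are orthogonal for the real
part of the inner product and ‖y‖² = ‖A x‖² + τ²‖x‖². -/
theorem norm_resolventAt_le (h : IsResolventPair Γ L N) {ε : ℝ} (hε : ε ^ 2 = 1) (s : ℝ) :
    ‖resolventAt L N ε s‖ ≤ (√(1 + s ^ 2))⁻¹ := by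
  have hpos : 0 < √(1 + s ^ 2) := Real.sqrt_pos.2 (by positivity)
  refine ContinuousLinearMap.opNorm_le_bound _ (inv_nonneg.2 hpos.le) fun y => ?_
  set x := resolventAt L N ε s y
  set t : ℝ := ε * √(1 + s ^ 2) with ht
  have hm := h.resolventAt_mem hε s y
  rw [← ht] at hm
  set w := y - (Complex.I * (t : ℂ)) • x with hw
  have hy : y = w + (Complex.I * (t : ℂ)) • x := by rw [hw]; abel
  have hsymm : inner ℂ w x = inner ℂ x w := h.inner_eq hm hm
  have h0 : RCLike.re (inner ℂ w ((Complex.I * (t : ℂ)) • x)) = 0 := by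
    have him : (inner ℂ w x).im = 0 := by
      have : (starRingEnd ℂ) (inner ℂ w x) = inner ℂ w x := by rw [inner_conj_symm, hsymm]
      exact Complex.conj_eq_iff_im.1 this
    rw [inner_smul_right]
    simp [him]
  have h1 : ‖y‖ ^ 2 = ‖w‖ ^ 2 + ‖(Complex.I * (t : ℂ)) • x‖ ^ 2 := by
    rw [hy, norm_add_sq (𝕜 := ℂ), h0]
    ring
  have h2 : ‖(Complex.I * (t : ℂ)) • x‖ = √(1 + s ^ 2) * ‖x‖ := by
    have hε' : |ε| = 1 := by rw [← Real.sqrt_sq_eq_abs, hε, Real.sqrt_one]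
    rw [norm_smul, norm_mul, Complex.norm_I, one_mul, Complex.norm_real, ht, norm_mul,
      Real.norm_eq_abs, hε', one_mul, Real.norm_of_nonneg hpos.le]
  have h3 : √(1 + s ^ 2) * ‖x‖ ≤ ‖y‖ := by
    rw [← h2]
    exact le_of_sq_le_sq (by nlinarith [sq_nonneg ‖w‖]) (norm_nonneg _)
  rw [inv_mul_eq_div, le_div_iff₀ hpos]
  linarith

theorem continuous_resolventAt (h : IsResolventPair Γ L N) (ε : ℝ) :
    Continuous (resolventAt L N ε) := by
  have := continuous_invOneAddSqMul h.nonneg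
  unfold resolventAt
  fun_prop

theorem isCompactOperator_resolventAt (hL : IsCompactOperator L)
    (hN : IsCompactOperator N) (ε s : ℝ) : IsCompactOperator (resolventAt L N ε s) := by
  have h1 : IsCompactOperator (N - (Complex.I * (ε * √(1 + s ^ 2) : ℝ)) • L) :=
    hN.sub (hL.smul (Complex.I * (ε * √(1 + s ^ 2) : ℝ)))
  exact h1.comp_clm (invOneAddSqMul L s)

/-- Partial fractions for A (1 + s² + A²)⁻¹. Each summand is a plain resolvent of A, so its
commutator with a involves [A, a] only once. -/
theorem resolventAt_add (s : ℝ) :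
    resolventAt L N 1 s + resolventAt L N (-1) s = (2 : ℂ) • (N * invOneAddSqMul L s) := by
  simp only [resolventAt, sub_mul, smul_mul_assoc]
  push_cast
  module

/-- `[(A + iτ)⁻¹, a] = -(A + iτ)⁻¹ [A, a] (A + iτ)⁻¹`. -/
theorem resolventAt_commutator (h : IsResolventPair Γ L N) {a M : H →L[ℂ] H}
    (haM : ∀ {x y}, (x, y) ∈ Γ → (a x, a y + M x) ∈ Γ) {ε : ℝ} (hε : ε ^ 2 = 1) (s : ℝ) :
    a * resolventAt L N ε s - resolventAt L N ε s * a
      = resolventAt L N ε s * M * resolventAt L N ε s := by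
  ext y
  have h1 := h.resolventAt_apply hε s (haM (h.resolventAt_mem hε s y))
  simp only [map_sub, map_add, map_smul] at h1
  simp only [_root_.sub_apply, mul_apply_eq_comp]
  linear_combination (norm := module) (-1 : ℂ) • h1

end IsResolventPair

/-- The compact operators form a closed subspace, so that integrals of compact operators are
compact. -/
theorem IsCompactOperator.integral {X : Type*} [MeasurableSpace X] {ν : Measure X}
    {f : X → H →L[ℂ] H} (hf : ∀ x, IsCompactOperator (f x)) :
    IsCompactOperator (∫ x, f x ∂ν : H →L[ℂ] H) := by
  by_cases hi : Integrable f ν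
  · set K : Submodule ℂ (H →L[ℂ] H) :=
      { carrier := {T | IsCompactOperator T}
        add_mem' := fun hS hT => IsCompactOperator.add hS hT
        zero_mem' := isCompactOperator_zero
        smul_mem' := fun c _ hT => IsCompactOperator.smul hT c } with hK
    have : IsClosed (K : Set (H →L[ℂ] H)) := isClosed_setOfPred_isCompactOperator
    -- The quotient map by the closed subspace of compact operators is continuous and linear, so it
    -- passes under the integral, where it kills the integrand.
    have h1 : K.mkQL (∫ x, f x ∂ν) = 0 := by
      rw [← ContinuousLinearMap.integral_comp_comm _ hi]
      have : ∀ x, K.mkQL (f x) = 0 := fun x => (Submodule.Quotient.mk_eq_zero K).2 (hf x)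
      simp [this]
    exact (Submodule.Quotient.mk_eq_zero K).1 h1
  -- The integral of a non-integrable function is 0 by convention, which is compact.
  · rw [integral_undef hi]
    exact isCompactOperator_zero

/-- The integrand in the integral formula for `[A (1 + A²)^{-1/2}, a]`, where `[A, a] = M`. -/
noncomputable def commutatorIntegrand (L N M : H →L[ℂ] H) (s : ℝ) : H →L[ℂ] H :=
  resolventAt L N 1 s * M * resolventAt L N 1 s
    + resolventAt L N (-1) s * M * resolventAt L N (-1) s

namespace IsResolventPair

variable {Γ : Submodule ℂ (H × H)} {L N : H →L[ℂ] H}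

theorem norm_resolventAt_mul_le (h : IsResolventPair Γ L N) {ε : ℝ} (hε : ε ^ 2 = 1)
    (M : H →L[ℂ] H) (s : ℝ) :
    ‖resolventAt L N ε s * M * resolventAt L N ε s‖ ≤ ‖M‖ * (1 + s ^ 2)⁻¹ := by
  have hpos : 0 < √(1 + s ^ 2) := Real.sqrt_pos.2 (by positivity)
  have h1 := h.norm_resolventAt_le hε s
  calc _ ≤ ‖resolventAt L N ε s‖ * ‖M‖ * ‖resolventAt L N ε s‖ :=
        (norm_mul_le _ _).trans (mul_le_mul_of_nonneg_right (norm_mul_le _ _) (norm_nonneg _))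
    _ ≤ (√(1 + s ^ 2))⁻¹ * ‖M‖ * (√(1 + s ^ 2))⁻¹ := by gcongr
    _ = ‖M‖ * (√(1 + s ^ 2) * √(1 + s ^ 2))⁻¹ := by rw [mul_inv]; ring
    _ = _ := by rw [Real.mul_self_sqrt (by positivity)]

theorem norm_commutatorIntegrand_le (h : IsResolventPair Γ L N) (M : H →L[ℂ] H) (s : ℝ) :
    ‖commutatorIntegrand L N M s‖ ≤ 2 * ‖M‖ * (1 + s ^ 2)⁻¹ := by
  have h1 := h.norm_resolventAt_mul_le (ε := 1) (by norm_num) M s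
  have h2 := h.norm_resolventAt_mul_le (ε := -1) (by norm_num) M s
  have := norm_add_le (resolventAt L N 1 s * M * resolventAt L N 1 s)
    (resolventAt L N (-1) s * M * resolventAt L N (-1) s)
  unfold commutatorIntegrand
  linarith

theorem continuous_commutatorIntegrand (h : IsResolventPair Γ L N) (M : H →L[ℂ] H) :
    Continuous (commutatorIntegrand L N M) := by
  have h1 := h.continuous_resolventAt 1
  have h2 := h.continuous_resolventAt (-1)
  unfold commutatorIntegrand
  fun_prop

theorem integrable_commutatorIntegrand (h : IsResolventPair Γ L N) (M : H →L[ℂ] H) :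
    Integrable (commutatorIntegrand L N M) :=
  (integrable_inv_one_add_sq.const_mul (2 * ‖M‖)).mono'
    (h.continuous_commutatorIntegrand M).aestronglyMeasurable
    (Eventually.of_forall (h.norm_commutatorIntegrand_le M))

/-- If `[A, a]` extends to the bounded operator `M`, then the commutator of `a` with the bounded
transform of `A` is a norm convergent integral. -/
theorem commutator_eq_integral (h : IsResolventPair Γ L N) {Q T : H →L[ℂ] H}
    (hT : IsTransformPair Γ L Q T) {a M : H →L[ℂ] H}
    (haM : ∀ {x y}, (x, y) ∈ Γ → (a x, a y + M x) ∈ Γ) :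
    a * T - T * a = ((2 * Real.pi)⁻¹ : ℝ) • ∫ s : ℝ, commutatorIntegrand L N M s := by
  obtain ⟨hi, hQ⟩ := sqrt_eq_integral h.nonneg
  rw [← hT.eq_sqrt] at hQ
  have hπ := Real.pi_pos.ne'
  -- the formula for `T` on the domain
  have hint : ∀ {x y}, (x, y) ∈ Γ → (Integrable fun s : ℝ => (N * invOneAddSqMul L s) x) ∧
      T x = Real.pi⁻¹ • ∫ s : ℝ, (N * invOneAddSqMul L s) x := fun {x y} hxy => by
    -- For x in the domain and y = A x, the kernel with N is traded for the norm integrable one with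
    -- L, applied to y.
    have e : ∀ s : ℝ, (N * invOneAddSqMul L s) x = (L * invOneAddSqMul L s) y := fun s => by
      rw [← (h.commute_inv s).eq, ← (commute_invOneAddSqMul (Commute.refl L) s).eq,
        mul_apply_eq_comp, mul_apply_eq_comp, h.left_apply hxy]
    simp_rw [e]
    refine ⟨hi.apply_continuousLinearMap y, ?_⟩
    rw [← ContinuousLinearMap.integral_apply hi, ← hQ, _root_.smul_apply, smul_smul,
      inv_mul_cancel₀ hπ, one_smul, hT.apply_fst h hxy]
  have hdom : ∀ {x y}, (x, y) ∈ Γ → (a * T - T * a) x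
      = (((2 * Real.pi)⁻¹ : ℝ) • ∫ s : ℝ, commutatorIntegrand L N M s) x := fun {x y} hxy => by
    obtain ⟨hi1, e1⟩ := hint hxy
    obtain ⟨hi2, e2⟩ := hint (haM hxy)
    -- The factor 2 comes from the two resolvents adding up to twice the kernel; it turns π⁻¹ into
    -- (2π)⁻¹.
    have e3 : ∀ s : ℝ, (commutatorIntegrand L N M s) x
        = (2 : ℝ) • (a ((N * invOneAddSqMul L s) x) - (N * invOneAddSqMul L s) (a x)) := fun s => by
      have c1 := h.resolventAt_commutator haM (ε := 1) (by norm_num) s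
      have c2 := h.resolventAt_commutator haM (ε := -1) (by norm_num) s
      have c3 := resolventAt_add (L := L) (N := N) s
      have : commutatorIntegrand L N M s = (2 : ℂ) • (a * (N * invOneAddSqMul L s)
          - (N * invOneAddSqMul L s) * a) := by
        rw [commutatorIntegrand, ← c1, ← c2, smul_sub, ← mul_smul_comm, ← smul_mul_assoc (2 : ℂ) (N * _),
          ← c3, mul_add, add_mul]
        abel
      rw [this, RCLike.real_smul_eq_coe_smul (K := ℂ)]
      simp
    rw [_root_.smul_apply, ContinuousLinearMap.integral_apply (h.integrable_commutatorIntegrand M)]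
    simp_rw [e3]
    have : (2 * Real.pi)⁻¹ * 2 = Real.pi⁻¹ := by field_simp
    rw [integral_smul, integral_sub (a.integrable_comp hi1) hi2, a.integral_comp_comm hi1,
      smul_smul, smul_sub, _root_.sub_apply, mul_apply_eq_comp, mul_apply_eq_comp, e1, e2,
      this, ContinuousLinearMap.map_smul_of_tower]
  -- Both sides are bounded and agree on the range of L, which lies in the domain and is dense.
  have hd : DenseRange L :=
    ContinuousLinearMap.denseRange_of_isSelfAdjoint h.isSelfAdjoint_left h.left_injective
  refine DFunLike.coe_injective (hd.equalizer (by fun_prop) (by fun_prop) (funext fun y => ?_))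
  exact hdom (h.mem_left y)

theorem isCompactOperator_commutatorIntegrand (hL : IsCompactOperator L)
    (hN : IsCompactOperator N) (M : H →L[ℂ] H) (s : ℝ) :
    IsCompactOperator (commutatorIntegrand L N M s) := by
  have h1 := (isCompactOperator_resolventAt hL hN 1 s).clm_comp (resolventAt L N 1 s * M)
  have h2 := (isCompactOperator_resolventAt hL hN (-1) s).clm_comp (resolventAt L N (-1) s * M)
  exact h1.add h2

theorem isCompactOperator_commutator (h : IsResolventPair Γ L N) (hL : IsCompactOperator L)
    (hN : IsCompactOperator N) {Q T : H →L[ℂ] H} (hT : IsTransformPair Γ L Q T) {a M : H →L[ℂ] H}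
    (haM : ∀ {x y}, (x, y) ∈ Γ → (a x, a y + M x) ∈ Γ) :
    IsCompactOperator (a * T - T * a : H →L[ℂ] H) := by
  rw [h.commutator_eq_integral hT haM]
  have h1 : IsCompactOperator (∫ s : ℝ, commutatorIntegrand L N M s : H →L[ℂ] H) :=
    IsCompactOperator.integral fun s => isCompactOperator_commutatorIntegrand hL hN M s
  exact h1.smul ((2 * Real.pi)⁻¹ : ℝ)

end IsResolventPair

end Commutator

/-! ### From the unbounded operator to a Kasparov cycle -/

section KasparovCycle

variable {H : Type*} [NormedAddCommGroup H] [InnerProductSpace ℂ H] [CompleteSpace H]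

theorem IsEssentiallySelfAdjoint.graph_closure {D : H →ₗ.[ℂ] H} (hD : IsEssentiallySelfAdjoint D) :
    (D.closure.graph : Set (H × H)) = closure (D.graph : Set (H × H)) := by
  have hcl : D.IsClosable := by
    -- If D were not closable, its closure would be D by convention; being self-adjoint it would be
    -- closed, hence closable.
    by_contra hn
    have h1 : D.IsClosed := by
      have := IsSelfAdjoint.isClosed hD
      rwa [LinearPMap.closure_def' hn] at this
    exact hn h1.isClosable
  rw [← hcl.graph_closure_eq_closure_graph, Submodule.topologicalClosure_coe]

/-- The passage from D to its closure: a relation known on the domain of D is encoded as a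
continuous self-map of H × H preserving the graph, and so preserves the closure of the graph. -/
theorem IsEssentiallySelfAdjoint.map_mem_graph {D : H →ₗ.[ℂ] H} (hD : IsEssentiallySelfAdjoint D)
    {f : H × H → H × H} (hf : Continuous f) (h : ∀ x : D.domain, f (x, D x) ∈ D.graph) {p : H × H}
    (hp : p ∈ D.closure.graph) : f p ∈ D.closure.graph := by
  have hp' : p ∈ closure (D.graph : Set (H × H)) := hD.graph_closure ▸ hp
  have : f p ∈ closure (D.graph : Set (H × H)) := map_mem_closure hf hp' fun q hq => by
    obtain ⟨x, h1, h2⟩ := D.mem_graph_iff.1 hq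
    have e : q = ((x : H), D x) := Prod.ext h1.symm h2.symm
    rw [e]
    exact h x
  rw [← hD.graph_closure] at this
  exact this

theorem IsEssentiallySelfAdjoint.dense_domain {D : H →ₗ.[ℂ] H} (hD : IsEssentiallySelfAdjoint D) :
    Dense (D.domain : Set H) := by
  have h1 : Dense (D.closure.domain : Set H) := IsSelfAdjoint.dense_domain hD
  refine dense_closure.1 (h1.mono fun x hx => ?_)
  have hx' : (x, D.closure ⟨x, hx⟩) ∈ closure (D.graph : Set (H × H)) :=
    hD.graph_closure ▸ D.closure.mem_graph ⟨x, hx⟩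
  exact map_mem_closure continuous_fst hx' fun q hq => by
    obtain ⟨x, h1, -⟩ := D.mem_graph_iff.1 hq
    rw [← h1]
    exact x.2

variable {G : Type*} [Group G] [TopologicalSpace G]

omit [CompleteSpace H] in
theorem GradedRep.rep_inv_apply (S : GradedRep G H) (g : G) (v : H) :
    S.rep g⁻¹ (S.rep g v) = v := by
  have : S.rep g⁻¹ * S.rep g = 1 := by rw [← map_mul, inv_mul_cancel, map_one]
  exact DFunLike.congr_fun this v

omit [CompleteSpace H] in
theorem GradedRep.rep_apply_inv (S : GradedRep G H) (g : G) (v : H) :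
    S.rep g (S.rep g⁻¹ v) = v := by
  simp

/-- For an almost equivariant operator, `[A, u_g]` extends to a bounded operator. -/
theorem IsAlmostEquivariant.exists_commutator {S : GradedRep G H} {D : H →ₗ.[ℂ] H}
    (hD : IsEssentiallySelfAdjoint D) (h : IsAlmostEquivariant S D) (g : G) :
    ∃ M : H →L[ℂ] H, ∀ {x y}, (x, y) ∈ D.closure.graph →
      (S.rep g x, S.rep g y + M x) ∈ D.closure.graph := by
  obtain ⟨hdom, hC⟩ := h
  obtain ⟨C, hC⟩ := hC g
  let f : D.domain →ₗ[ℂ] H :=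
    { toFun := fun x => D ⟨S.rep g x, hdom g x⟩ - S.rep g (D x)
      map_add' := fun x y => by
        have : (⟨S.rep g ((x + y : D.domain) : H), hdom g (x + y)⟩ : D.domain)
            = ⟨S.rep g x, hdom g x⟩ + ⟨S.rep g y, hdom g y⟩ := Subtype.ext (by simp)
        rw [this, D.map_add, D.map_add, map_add]
        abel
      map_smul' := fun c x => by
        have : (⟨S.rep g ((c • x : D.domain) : H), hdom g (c • x)⟩ : D.domain)
            = c • ⟨S.rep g x, hdom g x⟩ := Subtype.ext (by simp)
        rw [this, D.map_smul, D.map_smul, map_smul, RingHom.id_apply, smul_sub] }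
  have hf : ∀ x : D.domain, ‖f x‖ ≤ C * ‖D.domain.subtype x‖ := fun x => by
    -- The bound on g(D) - D at u_g x is the bound on [D, u_g] at x, because u_g is isometric.
    have h1 := hC ⟨S.rep g x, hdom g x⟩
    have e : (⟨S.rep g⁻¹ ((⟨S.rep g x, hdom g x⟩ : D.domain) : H),
        hdom g⁻¹ ⟨S.rep g x, hdom g x⟩⟩ : D.domain) = x := Subtype.ext (S.rep_inv_apply g x)
    rw [e, ← norm_neg, neg_sub] at h1
    simp only [LinearIsometryEquiv.norm_map] at h1
    exact h1
  have hd : DenseRange D.domain.subtype := by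
    have := hD.dense_domain
    rwa [DenseRange, Submodule.coe_subtype, Subtype.range_coe]
  refine ⟨f.extendOfNorm D.domain.subtype, fun {x y} hxy => ?_⟩
  refine hD.map_mem_graph (f := fun p : H × H =>
    (S.rep g p.1, S.rep g p.2 + f.extendOfNorm D.domain.subtype p.1)) ?_ (fun x => ?_) hxy
  · have := (S.rep g).continuous
    fun_prop
  · have h1 : f.extendOfNorm D.domain.subtype (x : H) = f x :=
      LinearMap.extendOfNorm_eq hd ⟨C, hf⟩ x
    have h2 : S.rep g (D x) + f x = D ⟨S.rep g x, hdom g x⟩ := by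
      change S.rep g (D x) + (D ⟨S.rep g x, hdom g x⟩ - S.rep g (D x)) = _
      abel
    simp only [h1, h2]
    exact D.mem_graph ⟨S.rep g x, hdom g x⟩

theorem isKasparovCycle_of_isTransformPair [TopologicalSpace.SeparableSpace H] {S : GradedRep G H}
    {D : H →ₗ.[ℂ] H} (hD : IsEssentiallySelfAdjoint D) (hodd : IsOddOperator S D)
    (heq : IsAlmostEquivariant S D) {L N Q T : H →L[ℂ] H}
    (h : IsResolventPair D.closure.graph L N) (hL : IsCompactOperator L) (hN : IsCompactOperator N)
    (hT : IsTransformPair D.closure.graph L Q T) : IsKasparovCycle S T where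
  separable := inferInstance
  odd v := by
    have h1 : ∀ {x y}, (x, y) ∈ D.closure.graph →
        ((S.grading : H →L[ℂ] H) x, -(S.grading : H →L[ℂ] H) y) ∈ D.closure.graph := fun {x y} hxy =>
      hD.map_mem_graph (f := fun p : H × H => (S.grading p.1, -S.grading p.2))
        (by have := S.grading.continuous; fun_prop)
        (fun x => by
          obtain ⟨hx, e⟩ := hodd x
          exact LinearPMap.mem_graph_of_apply_eq e) hxy
    exact DFunLike.congr_fun (hT.anticommute h h1) v
  isSelfAdjoint := hT.isSelfAdjoint h
  fredholm := by rwa [hT.one_sub_mul_self h]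
  almost_equivariant g := by
    obtain ⟨M, hM⟩ := heq.exists_commutator hD g
    have h1 := h.isCompactOperator_commutator hL hN hT (a := (S.rep g : H →L[ℂ] H)) hM
    -- g(T) - T = [u_g, T] u_g⁻¹, which reduces almost equivariance to the commutator formula with a
    -- = u_g.
    have h2 : S.conj g T - T = ((S.rep g : H →L[ℂ] H) * T - T * (S.rep g : H →L[ℂ] H))
        ∘L (S.rep g⁻¹ : H →L[ℂ] H) := by
      ext v
      change S.rep g (T (S.rep g⁻¹ v)) - T v
        = S.rep g (T (S.rep g⁻¹ v)) - T (S.rep g (S.rep g⁻¹ v))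
      rw [S.rep_apply_inv]
    rw [h2]
    exact h1.comp_clm _

end KasparovCycle

/-! ### Translation of functions under a proper action -/

section Translation

variable {G : Type*} [Group G] {E : Type*} [TopologicalSpace E] [MulAction G E]

theorem ZeroAtInftyContinuousMap.norm_le {f : C₀(E, ℂ)} {C : ℝ} (hC : 0 ≤ C) :
    ‖f‖ ≤ C ↔ ∀ x, ‖f x‖ ≤ C := by
  rw [← ZeroAtInftyContinuousMap.norm_toBCF_eq_norm, BoundedContinuousFunction.norm_le hC]
  rfl

theorem ZeroAtInftyContinuousMap.norm_coe_le (f : C₀(E, ℂ)) (x : E) : ‖f x‖ ≤ ‖f‖ :=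
  (ZeroAtInftyContinuousMap.norm_le (norm_nonneg f)).1 le_rfl x

/-- Evaluation at a point as a continuous linear functional. -/
noncomputable def ZeroAtInftyContinuousMap.evalCLM (x : E) : C₀(E, ℂ) →L[ℂ] ℂ :=
  LinearMap.mkContinuous
    { toFun := fun f => f x
      map_add' := fun _ _ => rfl
      map_smul' := fun _ _ => rfl } 1
    (fun f => by simpa using ZeroAtInftyContinuousMap.norm_coe_le f x)

theorem ZeroAtInftyContinuousMap.exists_eq_one_of_isCompact [T2Space E] [LocallyCompactSpace E]
    {K : Set E} (hK : IsCompact K) : ∃ e : C₀(E, ℂ), HasCompactSupport e ∧ ‖e‖ ≤ 1 ∧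
      ∀ x ∈ K, e x = 1 := by
  obtain ⟨f, h1, -, hc, hI⟩ := exists_continuous_one_zero_of_isCompact hK isClosed_empty
    (Set.disjoint_empty K)
  have hc' : HasCompactSupport fun x => (f x : ℂ) := hc.comp_left (g := fun r : ℝ => (r : ℂ)) (by simp)
  refine ⟨⟨⟨fun x => (f x : ℂ), by fun_prop⟩, hc'.is_zero_at_infty⟩, hc',
    (ZeroAtInftyContinuousMap.norm_le zero_le_one).2 fun x => ?_, fun x hx => ?_⟩
  · change ‖(f x : ℂ)‖ ≤ 1
    rw [Complex.norm_real, Real.norm_of_nonneg (hI x).1]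
    exact (hI x).2
  · change (f x : ℂ) = 1
    rw [h1 hx]
    simp

theorem HasCompactSupport.exists_mul_eq [T2Space E] [LocallyCompactSpace E] {φ : C₀(E, ℂ)}
    (hφ : HasCompactSupport φ) : ∃ e : C₀(E, ℂ), HasCompactSupport e ∧ ‖e‖ ≤ 1 ∧ e * φ = φ := by
  obtain ⟨e, h1, h2, h3⟩ := ZeroAtInftyContinuousMap.exists_eq_one_of_isCompact hφ
  refine ⟨e, h1, h2, ZeroAtInftyContinuousMap.ext fun x => ?_⟩
  rw [ZeroAtInftyContinuousMap.mul_apply]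
  by_cases hx : x ∈ tsupport φ
  · rw [h3 x hx, one_mul]
  · rw [image_eq_zero_of_notMem_tsupport hx, mul_zero]

section

variable [ContinuousConstSMul G E]

theorem c0Translate_sub (g : G) (φ ψ : C₀(E, ℂ)) :
    c0Translate g (φ - ψ) = c0Translate g φ - c0Translate g ψ := rfl

theorem c0Translate_mul (g : G) (φ ψ : C₀(E, ℂ)) :
    c0Translate g (φ * ψ) = c0Translate g φ * c0Translate g ψ := rfl

theorem c0Translate_star (g : G) (φ : C₀(E, ℂ)) :
    c0Translate g (star φ) = star (c0Translate g φ) := rfl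

theorem norm_c0Translate (g : G) (φ : C₀(E, ℂ)) : ‖c0Translate g φ‖ = ‖φ‖ := by
  refine le_antisymm ((ZeroAtInftyContinuousMap.norm_le (norm_nonneg _)).2 fun x =>
    ZeroAtInftyContinuousMap.norm_coe_le φ _)
    ((ZeroAtInftyContinuousMap.norm_le (norm_nonneg _)).2 fun x => ?_)
  have := ZeroAtInftyContinuousMap.norm_coe_le (c0Translate g φ) (g • x)
  rwa [c0Translate_apply, inv_smul_smul] at this

end

variable [TopologicalSpace G] [IsTopologicalGroup G] [LocallyCompactSpace G]

theorem HasCompactSupport.continuous_c0Translate [ContinuousSMul G E] {φ : C₀(E, ℂ)}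
    (hφ : HasCompactSupport φ) : Continuous fun g : G => c0Translate g φ := by
  refine continuous_iff_continuousAt.2 fun g₀ => ?_
  obtain ⟨V, hV, hVn⟩ := exists_compact_mem_nhds g₀
  -- For g in V every translate g(φ) is supported in the compact set K, so uniform convergence on K
  -- suffices.
  set K : Set E := (fun p : G × E => p.1 • p.2) '' (V ×ˢ tsupport φ) with hK
  have hKc : IsCompact K := (hV.prod hφ).image (by fun_prop)
  rw [ContinuousAt, Metric.tendsto_nhds]
  intro ε hε
  have hcont : ContinuousOn (Function.uncurry fun (g : G) (x : E) => φ (g⁻¹ • x))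
      (V ×ˢ K) := by
    have : Continuous (Function.uncurry fun (g : G) (x : E) => φ (g⁻¹ • x)) :=
      (map_continuous φ).comp ((continuous_fst.inv).smul continuous_snd)
    exact this.continuousOn
  obtain ⟨W, hW, hWε⟩ := hKc.mem_uniformity_of_prod hcont (mem_of_mem_nhds hVn)
    (Metric.dist_mem_uniformity (half_pos hε))
  rw [nhdsWithin_eq_nhds.2 hVn] at hW
  filter_upwards [hW, hVn] with g hgW hgV
  refine lt_of_le_of_lt ?_ (half_lt_self hε)
  rw [dist_eq_norm, ZeroAtInftyContinuousMap.norm_le (half_pos hε).le]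
  intro x
  rw [ZeroAtInftyContinuousMap.sub_apply, c0Translate_apply, c0Translate_apply]
  by_cases hx : x ∈ K
  · have := hWε g hgW x hx
    rw [← dist_eq_norm]
    exact le_of_lt this
  · have hz : ∀ h ∈ V, φ (h⁻¹ • x) = 0 := fun h hh => by
      by_contra hne
      exact hx ⟨(h, h⁻¹ • x), ⟨hh, subset_tsupport _ hne⟩, by simp⟩
    rw [hz g hgV, hz g₀ (mem_of_mem_nhds hVn), sub_zero, norm_zero]
    exact (half_pos hε).le

theorem continuous_c0Translate [ContinuousSMul G E]
    (hd : Dense {φ : C₀(E, ℂ) | HasCompactSupport φ}) (φ : C₀(E, ℂ)) :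
    Continuous fun g : G => c0Translate g φ := by
  refine continuous_iff_continuousAt.2 fun g₀ => ?_
  rw [ContinuousAt, Metric.tendsto_nhds]
  intro ε hε
  obtain ⟨ψ, hψ, hdist⟩ := Metric.dense_iff.1 hd φ (ε / 3) (by positivity)
  have h1 : ∀ g : G, dist (c0Translate g ψ) (c0Translate g φ) < ε / 3 := fun g => by
    rw [dist_eq_norm, ← c0Translate_sub, norm_c0Translate, ← dist_eq_norm]
    exact hψ
  have h2 := Metric.tendsto_nhds.1 ((HasCompactSupport.continuous_c0Translate (G := G) hdist).tendsto
    g₀) (ε / 3) (by positivity)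
  filter_upwards [h2] with g hg
  have h3 := dist_triangle4 (c0Translate g φ) (c0Translate g ψ) (c0Translate g₀ ψ)
    (c0Translate g₀ φ)
  have h4 := h1 g
  rw [dist_comm] at h4
  linarith [h1 g₀]

omit [IsTopologicalGroup G] [LocallyCompactSpace G] in
theorem isCompact_setOf_smul_inter [T2Space E] [ProperSMul G E] {K K' : Set E} (hK : IsCompact K)
    (hK' : IsCompact K') : IsCompact {g : G | ∃ x ∈ K, g • x ∈ K'} := by
  have h1 : IsCompact ((fun p : G × E => (p.1 • p.2, p.2)) ⁻¹' (K' ×ˢ K)) :=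
    (ProperSMul.isProperMap_smul_pair (G := G) (X := E)).isCompact_preimage (hK'.prod hK)
  convert h1.image continuous_fst using 1
  ext g
  simp only [Set.mem_ofPred_eq, Set.mem_image, Set.mem_preimage, Set.mem_prod, Prod.exists,
    exists_and_right, exists_eq_right]
  exact ⟨fun ⟨x, h, h'⟩ => ⟨x, h', h⟩, fun ⟨x, h', h⟩ => ⟨x, h, h'⟩⟩

omit [IsTopologicalGroup G] [LocallyCompactSpace G] in
theorem hasCompactSupport_c0Translate_mul [T2Space E] [T2Space G] [ProperSMul G E] {χ e : C₀(E, ℂ)}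
    (hχ : HasCompactSupport χ) (he : HasCompactSupport e) :
    HasCompactSupport fun g : G => c0Translate g χ * e := by
  refine HasCompactSupport.intro (isCompact_setOf_smul_inter (G := G) hχ he) fun g hg => ?_
  ext x
  by_contra hne
  rw [ZeroAtInftyContinuousMap.mul_apply, c0Translate_apply, ZeroAtInftyContinuousMap.zero_apply]
    at hne
  exact hg ⟨g⁻¹ • x, subset_tsupport _ (left_ne_zero_of_mul hne), by
    simpa using subset_tsupport _ (right_ne_zero_of_mul hne)⟩

omit [LocallyCompactSpace G] in
-- The bound has to be uniform in x. Left invariance of μ replaces x by a point of its orbit in the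
-- support of ψ; then the integrand lives on the set of g for which the translated support meets the
-- support, compact by properness and independent of x.
theorem exists_integral_translate_le [MeasurableSpace G] [BorelSpace G] [T2Space E] [T2Space G]
    [ProperSMul G E] (μ : Measure G) [μ.IsHaarMeasure] {ψ : C₀(E, ℂ)} (hψ : HasCompactSupport ψ) :
    ∃ C : ℝ, 0 ≤ C ∧ ∀ x, ‖∫ g : G, ψ (g⁻¹ • x) ∂μ‖ ≤ C := by
  set Z : Set G := {g : G | ∃ x ∈ tsupport ψ, g • x ∈ tsupport ψ} with hZ
  have hZc : IsCompact Z := isCompact_setOf_smul_inter hψ hψ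
  refine ⟨‖ψ‖ * μ.real Z, by positivity, fun x => ?_⟩
  by_cases hx : ∃ h : G, h⁻¹ • x ∈ tsupport ψ
  · obtain ⟨h, hh⟩ := hx
    have e : ∫ g : G, ψ (g⁻¹ • x) ∂μ = ∫ g : G, ψ (g⁻¹ • h⁻¹ • x) ∂μ := by
      rw [← integral_mul_left_eq_self (fun g : G => ψ (g⁻¹ • x)) h]
      simp only [mul_inv_rev, mul_smul]
    have hs : ∀ g ∉ Z, ψ (g⁻¹ • h⁻¹ • x) = 0 := fun g hg => by
      by_contra hne
      exact hg ⟨g⁻¹ • h⁻¹ • x, subset_tsupport _ hne, by simpa using hh⟩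
    rw [e, ← setIntegral_eq_integral_of_forall_compl_eq_zero hs]
    exact norm_setIntegral_le_of_norm_le_const hZc.measure_lt_top
      fun g _ => ZeroAtInftyContinuousMap.norm_coe_le ψ _
  · have h0 : ∀ g : G, ψ (g⁻¹ • x) = 0 := fun g => by
      by_contra hne
      exact hx ⟨g, subset_tsupport _ hne⟩
    simp only [h0, integral_zero, norm_zero]
    positivity

/-- `∫ g(ψ) e dμ(g)`, computed in `C₀(E)`. -/
theorem integral_c0Translate_mul [MeasurableSpace G] [BorelSpace G] [T2Space E] [T2Space G]
    [ProperSMul G E] (μ : Measure G) [μ.IsHaarMeasure] {ψ e : C₀(E, ℂ)}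
    (hψ : HasCompactSupport ψ) (he : HasCompactSupport e) :
    Integrable (fun g : G => c0Translate g ψ * e) μ ∧
      ∀ x, (∫ g : G, c0Translate g ψ * e ∂μ) x = (∫ g : G, ψ (g⁻¹ • x) ∂μ) * e x := by
  -- The factor e makes the integrand compactly supported in g.
  have hi : Integrable (fun g : G => c0Translate g ψ * e) μ :=
    ((HasCompactSupport.continuous_c0Translate hψ).mul continuous_const).integrable_of_hasCompactSupport
      (hasCompactSupport_c0Translate_mul hψ he)
  refine ⟨hi, fun x => ?_⟩
  have := (ZeroAtInftyContinuousMap.evalCLM x).integral_comp_comm hi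
  rw [← integral_mul_const]
  exact this.symm

end Translation

/-! ### Weak integrals and square integrable families -/

section WeakIntegral

variable {G H : Type*} [NormedAddCommGroup H] [InnerProductSpace ℂ H]

theorem ContinuousLinearMap.opNorm_le_of_inner {R : H →L[ℂ] H} {C : ℝ} (hC : 0 ≤ C)
    (h : ∀ v w, ‖inner ℂ v (R w)‖ ≤ C * ‖v‖ * ‖w‖) : ‖R‖ ≤ C := by
  refine R.opNorm_le_bound hC fun w => ?_
  by_contra! hlt
  have h1 := h (R w) w
  rw [inner_self_eq_norm_sq_to_K] at h1
  have h2 : ‖((‖R w‖ : ℂ)) ^ 2‖ = ‖R w‖ * ‖R w‖ := by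
    rw [norm_pow, Complex.norm_real, norm_norm, sq]
  have h3 : 0 < ‖R w‖ := lt_of_le_of_lt (by positivity) hlt
  have h4 : ‖R w‖ * ‖R w‖ ≤ C * ‖R w‖ * ‖w‖ := by
    rw [← h2]
    exact h1
  nlinarith

variable [MeasurableSpace G] {μ : Measure G}

/-- A family of operators which is square integrable: `∫ ‖P_g v‖² dμ(g) ≤ A ‖v‖²`. -/
def IsSquareIntegrable (μ : Measure G) (P : G → H →L[ℂ] H) (A : ℝ) : Prop :=
  ∀ v, Integrable (fun g => ‖P g v‖ ^ 2) μ ∧ ∫ g, ‖P g v‖ ^ 2 ∂μ ≤ A * ‖v‖ ^ 2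

theorem IsSquareIntegrable.integral_mul_le {P P' : G → H →L[ℂ] H} {A A' : ℝ}
    (hP : IsSquareIntegrable μ P A) (hP' : IsSquareIntegrable μ P' A')
    (hm : ∀ v, AEStronglyMeasurable (fun g => ‖P g v‖) μ)
    (hm' : ∀ v, AEStronglyMeasurable (fun g => ‖P' g v‖) μ) (v w : H) :
    Integrable (fun g => ‖P g v‖ * ‖P' g w‖) μ ∧
      ∫ g, ‖P g v‖ * ‖P' g w‖ ∂μ ≤ (A + A') / 2 * ‖v‖ * ‖w‖ := by
  obtain ⟨i1, b1⟩ := hP v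
  obtain ⟨i2, b2⟩ := hP' w
  have hi : Integrable (fun g => ‖P g v‖ * ‖P' g w‖) μ := by
    refine (i1.add i2).mono' ((hm v).mul (hm' w)) (Eventually.of_forall fun g => ?_)
    rw [Real.norm_of_nonneg (by positivity)]
    simp only [Pi.add_apply]
    nlinarith [sq_nonneg (‖P g v‖ - ‖P' g w‖), sq_nonneg ‖P g v‖, sq_nonneg ‖P' g w‖]
  refine ⟨hi, ?_⟩
  rcases eq_or_ne v 0 with rfl | hv
  · simp
  rcases eq_or_ne w 0 with rfl | hw
  · simp
  have hv' : 0 < ‖v‖ := norm_pos_iff.2 hv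
  have hw' : 0 < ‖w‖ := norm_pos_iff.2 hw
  -- The weight in 2ab ≤ r a² + r⁻¹ b² that balances ‖v‖² and ‖w‖² into ‖v‖ ‖w‖.
  set r : ℝ := ‖w‖ / ‖v‖ with hr
  have hr0 : 0 < r := by positivity
  have h1 : ∫ g, ‖P g v‖ * ‖P' g w‖ ∂μ
      ≤ ∫ g, ((r / 2) * ‖P g v‖ ^ 2 + (r⁻¹ / 2) * ‖P' g w‖ ^ 2) ∂μ := by
    refine integral_mono hi ((i1.const_mul _).add (i2.const_mul _)) fun g => ?_
    have h2 : 0 ≤ r⁻¹ * (r * ‖P g v‖ - ‖P' g w‖) ^ 2 := by positivity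
    have h3 : r⁻¹ * (r * ‖P g v‖ - ‖P' g w‖) ^ 2
        = r * ‖P g v‖ ^ 2 - 2 * (‖P g v‖ * ‖P' g w‖) + r⁻¹ * ‖P' g w‖ ^ 2 := by
      field_simp
      ring
    simp only
    linarith
  rw [integral_add (i1.const_mul _) (i2.const_mul _), integral_const_mul, integral_const_mul] at h1
  refine h1.trans ?_
  have h4 : (r / 2) * (A * ‖v‖ ^ 2) + (r⁻¹ / 2) * (A' * ‖w‖ ^ 2)
      = (A + A') / 2 * ‖v‖ * ‖w‖ := by
    rw [hr]
    field_simp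
  rw [← h4]
  gcongr

theorem IsWeakIntegral.unique {f : G → H →L[ℂ] H} {R R' : H →L[ℂ] H} (h : IsWeakIntegral μ f R)
    (h' : IsWeakIntegral μ f R') : R = R' := by
  ext w
  exact ext_inner_left ℂ fun v => by rw [← (h v w).2, ← (h' v w).2]

theorem IsWeakIntegral.sub {f f' : G → H →L[ℂ] H} {R R' : H →L[ℂ] H} (h : IsWeakIntegral μ f R)
    (h' : IsWeakIntegral μ f' R') : IsWeakIntegral μ (fun g => f g - f' g) (R - R') := fun v w => by
  obtain ⟨i1, e1⟩ := h v w
  obtain ⟨i2, e2⟩ := h' v w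
  simp only [_root_.sub_apply, inner_sub_right]
  exact ⟨i1.sub i2, by rw [integral_sub i1 i2, e1, e2]⟩

theorem IsWeakIntegral.mul_const {f : G → H →L[ℂ] H} {R : H →L[ℂ] H} (h : IsWeakIntegral μ f R)
    (X : H →L[ℂ] H) : IsWeakIntegral μ (fun g => f g * X) (R * X) := fun v w => h v (X w)

theorem IsWeakIntegral.norm_le {f : G → H →L[ℂ] H} {R : H →L[ℂ] H} (h : IsWeakIntegral μ f R)
    {P P' : G → H →L[ℂ] H} {A A' K : ℝ} (hA : 0 ≤ A) (hA' : 0 ≤ A') (hK : 0 ≤ K)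
    (hP : IsSquareIntegrable μ P A) (hP' : IsSquareIntegrable μ P' A')
    (hm : ∀ v, AEStronglyMeasurable (fun g => ‖P g v‖) μ)
    (hm' : ∀ v, AEStronglyMeasurable (fun g => ‖P' g v‖) μ)
    (hf : ∀ g v w, ‖inner ℂ v (f g w)‖ ≤ K * (‖P g v‖ * ‖P' g w‖)) :
    ‖R‖ ≤ K * ((A + A') / 2) := by
  refine ContinuousLinearMap.opNorm_le_of_inner (by positivity) fun v w => ?_
  obtain ⟨i, b⟩ := hP.integral_mul_le hP' hm hm' v w
  rw [← (h v w).2]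
  calc ‖∫ g, inner ℂ v (f g w) ∂μ‖ ≤ ∫ g, K * (‖P g v‖ * ‖P' g w‖) ∂μ :=
        norm_integral_le_of_norm_le (i.const_mul K) (Eventually.of_forall fun g => hf g v w)
    _ = K * ∫ g, ‖P g v‖ * ‖P' g w‖ ∂μ := integral_const_mul _ _
    _ ≤ K * ((A + A') / 2 * ‖v‖ * ‖w‖) := by gcongr
    _ = _ := by ring

/-- The pairing of P with P' bounds the integrated sesquilinear form, and Riesz representation
supplies the operator. -/
theorem exists_isWeakIntegral [CompleteSpace H] {f : G → H →L[ℂ] H}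
    {P P' : G → H →L[ℂ] H} {A A' K : ℝ} (hK : 0 ≤ K)
    (hP : IsSquareIntegrable μ P A) (hP' : IsSquareIntegrable μ P' A')
    (hm : ∀ v, AEStronglyMeasurable (fun g => ‖P g v‖) μ)
    (hm' : ∀ v, AEStronglyMeasurable (fun g => ‖P' g v‖) μ)
    (hfm : ∀ v w, AEStronglyMeasurable (fun g => inner ℂ v (f g w)) μ)
    (hf : ∀ g v w, ‖inner ℂ v (f g w)‖ ≤ K * (‖P g v‖ * ‖P' g w‖)) :
    ∃ R, IsWeakIntegral μ f R := by
  have hi : ∀ v w, Integrable (fun g => inner ℂ v (f g w)) μ := fun v w =>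
    ((hP.integral_mul_le hP' hm hm' v w).1.const_mul K).mono' (hfm v w)
      (Eventually.of_forall fun g => hf g v w)
  have hb : ∀ v w, ‖∫ g, inner ℂ v (f g w) ∂μ‖ ≤ K * ((A + A') / 2) * ‖v‖ * ‖w‖ := fun v w => by
    obtain ⟨i, b⟩ := hP.integral_mul_le hP' hm hm' v w
    calc ‖∫ g, inner ℂ v (f g w) ∂μ‖ ≤ ∫ g, K * (‖P g v‖ * ‖P' g w‖) ∂μ :=
          norm_integral_le_of_norm_le (i.const_mul K) (Eventually.of_forall fun g => hf g v w)
      _ = K * ∫ g, ‖P g v‖ * ‖P' g w‖ ∂μ := integral_const_mul _ _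
      _ ≤ K * ((A + A') / 2 * ‖v‖ * ‖w‖) := by gcongr
      _ = _ := by ring
  let B : H →L⋆[ℂ] H →L[ℂ] ℂ := LinearMap.mkContinuous₂
    (LinearMap.mk₂'ₛₗ (starRingEnd ℂ) (RingHom.id ℂ) (fun v w => ∫ g, inner ℂ v (f g w) ∂μ)
      (fun v v' w => by simp only [inner_add_left]; exact integral_add (hi v w) (hi v' w))
      (fun c v w => by simp only [inner_smul_left]; exact integral_const_mul _ _)
      (fun v w w' => by simp only [map_add, inner_add_right]; exact integral_add (hi v w) (hi v w'))
      (fun c v w => by simp only [map_smul, inner_smul_right]; exact integral_const_mul _ _))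
    (K * ((A + A') / 2)) hb
  -- The operator representing B acts on the left-hand vector of the inner product; its adjoint acts
  -- on w.
  refine ⟨ContinuousLinearMap.adjoint (InnerProductSpace.continuousLinearMapOfBilin B),
    fun v w => ⟨hi v w, ?_⟩⟩
  rw [ContinuousLinearMap.adjoint_inner_right,
    InnerProductSpace.continuousLinearMapOfBilin_apply]
  rfl

/-- Strong convergence of a bounded family of operators to zero becomes norm convergence after
multiplication by a compact operator. -/
theorem tendsto_mul_of_isCompactOperator {X : Type*} {l : Filter X} {P : X → H →L[ℂ] H} {C : ℝ}
    (hC : ∀ x, ‖P x‖ ≤ C) (hP : ∀ v, Tendsto (fun x => P x v) l (𝓝 0)) {R : H →L[ℂ] H}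
    (hR : IsCompactOperator R) : Tendsto (fun x => P x * R) l (𝓝 0) := by
  rw [Metric.tendsto_nhds]
  intro ε hε
  obtain ⟨K, hK, hsub⟩ := hR.image_closedBall_subset_compact (1 : ℝ)
  have hC0 : 0 < |C| + 1 := by positivity
  obtain ⟨t, -, htf, ht⟩ := hK.finite_cover_balls (e := ε / 4 / (|C| + 1)) (by positivity)
  have hev : ∀ᶠ x in l, ∀ y ∈ t, ‖P x y‖ < ε / 4 := by
    rw [eventually_all_finite htf]
    intro y _
    have := (hP y).norm
    rw [norm_zero] at this
    exact this.eventually_lt_const (by positivity)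
  filter_upwards [hev] with x hx
  rw [dist_zero_right]
  refine lt_of_le_of_lt (ContinuousLinearMap.opNorm_le_of_unit_norm (C := ε / 2)
    (by positivity) fun v hv => ?_) (half_lt_self hε)
  have hRv : R v ∈ K := hsub ⟨v, by simp [hv], rfl⟩
  obtain ⟨y, hy, hball⟩ := Set.mem_iUnion₂.1 (ht hRv)
  have h1 : ‖R v - y‖ < ε / 4 / (|C| + 1) := by rwa [← dist_eq_norm]
  have h2 : ‖P x (R v - y)‖ ≤ ε / 4 := by
    calc ‖P x (R v - y)‖ ≤ ‖P x‖ * ‖R v - y‖ := (P x).le_opNorm _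
      _ ≤ (|C| + 1) * (ε / 4 / (|C| + 1)) := by
          gcongr
          exact (hC x).trans ((le_abs_self C).trans (by linarith))
      _ = ε / 4 := by field_simp
  have h3 : (P x * R) v = P x (R v - y) + P x y := by
    rw [map_sub, sub_add_cancel]
    rfl
  rw [h3]
  exact (norm_add_le _ _).trans (by linarith [hx y hy])

/-- Joint continuity of matrix coefficients of a bounded, weakly continuous family. -/
theorem continuous_inner_of_weak {G X : Type*} [TopologicalSpace G] [TopologicalSpace X]
    {M : G → H →L[ℂ] H} {C : ℝ}
    (hC : ∀ g, ‖M g‖ ≤ C) (hM : ∀ v w, Continuous fun g => inner ℂ v (M g w)) {γ : X → G}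
    {p q : X → H} (hγ : Continuous γ) (hp : Continuous p) (hq : Continuous q) :
    Continuous fun x => inner ℂ (p x) (M (γ x) (q x)) := by
  refine continuous_iff_continuousAt.2 fun x₀ => ?_
  have hM' : ∀ x v, ‖M x v‖ ≤ C * ‖v‖ := fun x v => (M x).le_of_opNorm_le (hC x) v
  have h1 : Tendsto (fun x => inner ℂ (p x - p x₀) (M (γ x) (q x))) (𝓝 x₀) (𝓝 0) := by
    refine squeeze_zero_norm (a := fun x => ‖p x - p x₀‖ * (C * ‖q x‖)) (fun x => ?_) ?_
    · exact (norm_inner_le_norm _ _).trans (by gcongr; exact hM' _ _)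
    · have : Continuous fun x => ‖p x - p x₀‖ * (C * ‖q x‖) := by fun_prop
      simpa using this.tendsto x₀
  have h2 : Tendsto (fun x => inner ℂ (p x₀) (M (γ x) (q x - q x₀))) (𝓝 x₀) (𝓝 0) := by
    refine squeeze_zero_norm (a := fun x => ‖p x₀‖ * (C * ‖q x - q x₀‖)) (fun x => ?_) ?_
    · exact (norm_inner_le_norm _ _).trans (by gcongr; exact hM' _ _)
    · have : Continuous fun x => ‖p x₀‖ * (C * ‖q x - q x₀‖) := by fun_prop
      simpa using this.tendsto x₀
  have h3 : Tendsto (fun x => inner ℂ (p x₀) (M (γ x) (q x₀))) (𝓝 x₀)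
      (𝓝 (inner ℂ (p x₀) (M (γ x₀) (q x₀)))) := ((hM _ _).comp hγ).tendsto x₀
  have h4 := (h1.add h2).add h3
  rw [zero_add, zero_add] at h4
  refine h4.congr fun x => ?_
  simp only [inner_sub_left, map_sub, inner_sub_right]
  ring

end WeakIntegral

/-! ### Representations of C₀(E): localized vectors and square integrability -/

theorem IsCutoff.star_eq {G E : Type*} [Group G] [MeasurableSpace G] [TopologicalSpace E]
    [MulAction G E] {μ : Measure G} {c : C₀(E, ℂ)} (hc : IsCutoff μ c) : star c = c := by
  ext x
  exact (Complex.conj_eq_iff_im.2 (Complex.nonneg_iff.1 (hc.nonneg x)).2.symm)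

section Representation

variable {G H E : Type*} [Group G] [TopologicalSpace G] [NormedAddCommGroup H]
  [InnerProductSpace ℂ H] [CompleteSpace H] {S : GradedRep G H} [TopologicalSpace E] [MulAction G E]
  [ContinuousConstSMul G E] (π : EquivariantRep S E)

namespace EquivariantRep

theorem norm_hom_le (φ : C₀(E, ℂ)) : ‖π.hom φ‖ ≤ ‖φ‖ := NonUnitalStarAlgHom.norm_apply_le π.hom φ

/-- The representation as a continuous linear map. -/
noncomputable def homCLM : C₀(E, ℂ) →L[ℂ] (H →L[ℂ] H) :=
  LinearMap.mkContinuous (π.hom : C₀(E, ℂ) →ₗ[ℂ] (H →L[ℂ] H)) 1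
    (fun φ => by simpa using π.norm_hom_le φ)

theorem continuous_hom : Continuous π.hom := π.homCLM.continuous

theorem hom_mul_apply (φ ψ : C₀(E, ℂ)) (v : H) : π.hom (φ * ψ) v = π.hom φ (π.hom ψ v) := by
  rw [map_mul]
  rfl

theorem inner_hom_left (φ : C₀(E, ℂ)) (v w : H) :
    inner ℂ (π.hom φ v) w = inner ℂ v (π.hom (star φ) w) := by
  rw [map_star, ContinuousLinearMap.star_eq_adjoint, ContinuousLinearMap.adjoint_inner_right]

/-- Vectors on which some compactly supported function acts as the identity. -/
def IsLocalized (v : H) : Prop :=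
  ∃ e : C₀(E, ℂ), HasCompactSupport e ∧ ‖e‖ ≤ 1 ∧ π.hom e v = v

/-- Localized vectors are those on which integrals of translates reduce to Bochner integrals in
C₀(E). They form a subspace, since one function can equal 1 on two compact supports at once; its
closure contains every φ v, so nondegeneracy gives density. -/
theorem dense_isLocalized [T2Space E] [LocallyCompactSpace E]
    (hd : Dense {φ : C₀(E, ℂ) | HasCompactSupport φ}) : Dense {v | π.IsLocalized v} := by
  let V : Submodule ℂ H :=
    { carrier := {v | π.IsLocalized v}
      add_mem' := by
        rintro v w ⟨e, he, -, hv⟩ ⟨f, hf, -, hw⟩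
        obtain ⟨k, hk, hk1, hke⟩ := ZeroAtInftyContinuousMap.exists_eq_one_of_isCompact
          (E := E) (he.isCompact.union hf.isCompact)
        have h2 : k * e = e := ZeroAtInftyContinuousMap.ext fun x => by
          rw [ZeroAtInftyContinuousMap.mul_apply]
          by_cases hx : x ∈ tsupport e
          · rw [hke x (Or.inl hx), one_mul]
          · rw [image_eq_zero_of_notMem_tsupport hx, mul_zero]
        have h3 : k * f = f := ZeroAtInftyContinuousMap.ext fun x => by
          rw [ZeroAtInftyContinuousMap.mul_apply]
          by_cases hx : x ∈ tsupport f
          · rw [hke x (Or.inr hx), one_mul]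
          · rw [image_eq_zero_of_notMem_tsupport hx, mul_zero]
        refine ⟨k, hk, hk1, ?_⟩
        have h4 : π.hom k v = v := by
          conv_lhs => rw [← hv, ← π.hom_mul_apply, h2, hv]
        have h5 : π.hom k w = w := by
          conv_lhs => rw [← hw, ← π.hom_mul_apply, h3, hw]
        rw [map_add, h4, h5]
      zero_mem' := ⟨0, HasCompactSupport.zero, by simp, by simp⟩
      smul_mem' := by
        rintro c v ⟨e, he, he1, hv⟩
        exact ⟨e, he, he1, by rw [map_smul, hv]⟩ }
  have hle : Submodule.span ℂ {w : H | ∃ φ v, w = π.hom φ v} ≤ V.topologicalClosure := by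
    refine Submodule.span_le.2 ?_
    rintro w ⟨φ, v, rfl⟩
    have h1 : π.hom φ v ∈ closure (V : Set H) := by
      have hc : Continuous fun ψ => π.hom ψ v := π.continuous_hom.clm_apply continuous_const
      refine map_mem_closure (f := fun ψ => π.hom ψ v) hc (hd φ) fun ψ hψ => ?_
      obtain ⟨e, he, he1, hee⟩ := HasCompactSupport.exists_mul_eq hψ
      exact ⟨e, he, he1, by rw [← π.hom_mul_apply, hee]⟩
    exact h1
  have h2 : Dense (V.topologicalClosure : Set H) := π.nondegenerate.mono hle
  rw [Submodule.topologicalClosure_coe] at h2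
  exact dense_closure.1 h2

variable {π} in
theorem IsLocalized.hom_mul_apply_eq {v : H} {e : C₀(E, ℂ)} (hv : π.hom e v = v) (φ : C₀(E, ℂ)) :
    π.hom (φ * e) v = π.hom φ v := by
  rw [π.hom_mul_apply, hv]

end EquivariantRep

end Representation

section ProperRepresentation

variable {G H E : Type*} [Group G] [TopologicalSpace G] [IsTopologicalGroup G] [T2Space G]
  [LocallyCompactSpace G]
  [NormedAddCommGroup H] [InnerProductSpace ℂ H] [CompleteSpace H] {S : GradedRep G H}
  [TopologicalSpace E] [T2Space E] [LocallyCompactSpace E] [MulAction G E] [ProperSMul G E]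
  (π : EquivariantRep S E)

namespace EquivariantRep

omit [IsTopologicalGroup G] [LocallyCompactSpace G] in
-- On a vector fixed by e, g(χ) acts as g(χ) e, which vanishes for g outside a compact set. Density
-- and the uniform bound ‖g(χ)‖ = ‖χ‖ give the rest.
theorem tendsto_hom_c0Translate (hd : Dense {φ : C₀(E, ℂ) | HasCompactSupport φ}) {χ : C₀(E, ℂ)}
    (hχ : HasCompactSupport χ) (v : H) :
    Tendsto (fun g : G => π.hom (c0Translate g χ) v) (cocompact G) (𝓝 0) := by
  rw [Metric.tendsto_nhds]
  intro ε hε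
  obtain ⟨w, hw, e, he, -, hew⟩ := Metric.dense_iff.1 (π.dense_isLocalized hd) v
    (ε / (‖χ‖ + 1)) (by positivity)
  filter_upwards [(hasCompactSupport_c0Translate_mul (G := G) hχ he).isCompact.compl_mem_cocompact]
    with g hg
  have h1 : π.hom (c0Translate g χ) w = 0 := by
    have h0 : c0Translate g χ * e = 0 :=
      image_eq_zero_of_notMem_tsupport (f := fun g : G => c0Translate g χ * e) hg
    rw [← IsLocalized.hom_mul_apply_eq hew, h0, map_zero]
    rfl
  have h2 : π.hom (c0Translate g χ) v = π.hom (c0Translate g χ) (v - w) := by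
    rw [map_sub, h1, sub_zero]
  rw [dist_zero_right, h2]
  have h3 : ‖v - w‖ < ε / (‖χ‖ + 1) := by
    rw [← dist_eq_norm, dist_comm]
    exact hw
  calc ‖π.hom (c0Translate g χ) (v - w)‖ ≤ ‖χ‖ * ‖v - w‖ :=
        (π.hom _).le_of_opNorm_le ((π.norm_hom_le _).trans (norm_c0Translate g χ).le) _
    _ ≤ (‖χ‖ + 1) * ‖v - w‖ := by gcongr; linarith
    _ < (‖χ‖ + 1) * (ε / (‖χ‖ + 1)) := by gcongr
    _ = ε := by field_simp

omit [T2Space G] [T2Space E] [LocallyCompactSpace E] in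
theorem continuous_hom_c0Translate (hd : Dense {φ : C₀(E, ℂ) | HasCompactSupport φ})
    (φ : C₀(E, ℂ)) : Continuous fun g : G => π.hom (c0Translate g φ) :=
  π.continuous_hom.comp (continuous_c0Translate hd φ)

variable [MeasurableSpace G] [BorelSpace G] (μ : Measure G) [μ.IsHaarMeasure]

omit [LocallyCompactSpace E] in
theorem integral_inner_of_localized {ψ e : C₀(E, ℂ)} (hψ : HasCompactSupport ψ)
    (he : HasCompactSupport e) {v : H} (hv : π.hom e v = v) (w : H) :
    Integrable (fun g : G => inner ℂ w (π.hom (c0Translate g ψ) v)) μ ∧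
      ∫ g : G, inner ℂ w (π.hom (c0Translate g ψ) v) ∂μ
        = inner ℂ w (π.hom (∫ g : G, c0Translate g ψ * e ∂μ) v) := by
  obtain ⟨hi, -⟩ := integral_c0Translate_mul μ hψ he
  let Λ : C₀(E, ℂ) →L[ℂ] ℂ :=
    (innerSL ℂ w) ∘L (ContinuousLinearMap.apply ℂ H v) ∘L π.homCLM
  have hΛ : ∀ g : G, inner ℂ w (π.hom (c0Translate g ψ) v) = Λ (c0Translate g ψ * e) := fun g => by
    rw [← IsLocalized.hom_mul_apply_eq hv]
    rfl
  simp_rw [hΛ]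
  exact ⟨Λ.integrable_comp hi, Λ.integral_comp_comm hi⟩

/-- The square integral is ⟨v, ∫ g(|χ|²) dμ(g) v⟩, and A bounds the orbit integrals of |χ|². This is
proved for localized v; the general case follows by approximation. -/
theorem exists_isSquareIntegrable (hd : Dense {φ : C₀(E, ℂ) | HasCompactSupport φ}) {χ : C₀(E, ℂ)}
    (hχ : HasCompactSupport χ) :
    ∃ A : ℝ, 0 ≤ A ∧ IsSquareIntegrable μ (fun g : G => π.hom (c0Translate g χ)) A := by
  have hψ : HasCompactSupport (star χ * χ : C₀(E, ℂ)) := by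
    have : HasCompactSupport (fun x => star χ x * χ x) := hχ.mul_left
    exact this
  obtain ⟨A, hA, hAx⟩ := exists_integral_translate_le (G := G) μ hψ
  refine ⟨A, hA, ?_⟩
  have hsq : ∀ (g : G) (v : H), (((‖π.hom (c0Translate g χ) v‖ ^ 2 : ℝ)) : ℂ)
      = inner ℂ v (π.hom (c0Translate g (star χ * χ)) v) := fun g v => by
    rw [c0Translate_mul, c0Translate_star, π.hom_mul_apply, ← π.inner_hom_left,
      inner_self_eq_norm_sq_to_K]
    push_cast
    rfl
  have hloc : ∀ v, π.IsLocalized v →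
      Integrable (fun g : G => ‖π.hom (c0Translate g χ) v‖ ^ 2) μ ∧
      ∫ g : G, ‖π.hom (c0Translate g χ) v‖ ^ 2 ∂μ ≤ A * ‖v‖ ^ 2 := by
    rintro v ⟨e, he, he1, hv⟩
    obtain ⟨hi, h1⟩ := π.integral_inner_of_localized μ hψ he hv v
    obtain ⟨-, h2⟩ := integral_c0Translate_mul μ hψ he
    simp_rw [← hsq] at hi h1
    refine ⟨by simpa only [RCLike.re_to_complex, Complex.ofReal_re] using hi.re, ?_⟩
    have h3 : ‖∫ g : G, c0Translate g (star χ * χ) * e ∂μ‖ ≤ A := by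
      refine (ZeroAtInftyContinuousMap.norm_le hA).2 fun x => ?_
      rw [h2, norm_mul]
      calc _ ≤ A * 1 := by
            gcongr
            · exact hAx x
            · exact (ZeroAtInftyContinuousMap.norm_coe_le e x).trans he1
        _ = A := mul_one A
    rw [integral_complex_ofReal] at h1
    have h4 : ∫ g : G, ‖π.hom (c0Translate g χ) v‖ ^ 2 ∂μ
        ≤ ‖((∫ g : G, ‖π.hom (c0Translate g χ) v‖ ^ 2 ∂μ : ℝ) : ℂ)‖ := by
      rw [Complex.norm_real]
      exact le_abs_self _
    refine h4.trans ?_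
    rw [h1]
    calc _ ≤ ‖v‖ * ‖π.hom (∫ g : G, c0Translate g (star χ * χ) * e ∂μ) v‖ := norm_inner_le_norm _ _
      _ ≤ ‖v‖ * (A * ‖v‖) := by
          gcongr
          exact (π.hom _).le_of_opNorm_le ((π.norm_hom_le _).trans h3) v
      _ = _ := by ring
  intro v
  obtain ⟨u, hu, hlim⟩ := mem_closure_iff_seq_limit.1 (π.dense_isLocalized hd v)
  have hcont : ∀ w, Continuous fun g : G => ‖π.hom (c0Translate g χ) w‖ ^ 2 := fun w =>
    (((π.continuous_hom_c0Translate hd χ).clm_apply continuous_const).norm).pow 2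
  -- Fatou's lemma along localized vectors converging to v.
  have hF : ∫⁻ g : G, ENNReal.ofReal (‖π.hom (c0Translate g χ) v‖ ^ 2) ∂μ
      ≤ ENNReal.ofReal (A * ‖v‖ ^ 2) := by
    have h1 : ∀ g : G, ENNReal.ofReal (‖π.hom (c0Translate g χ) v‖ ^ 2)
        = liminf (fun n => ENNReal.ofReal (‖π.hom (c0Translate g χ) (u n)‖ ^ 2)) atTop := fun g => by
      refine (Tendsto.liminf_eq ?_).symm
      have : Continuous fun w => ENNReal.ofReal (‖π.hom (c0Translate g χ) w‖ ^ 2) :=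
        ENNReal.continuous_ofReal.comp (by fun_prop)
      exact (this.tendsto v).comp hlim
    have h2 : Tendsto (fun n => ENNReal.ofReal (A * ‖u n‖ ^ 2)) atTop
        (𝓝 (ENNReal.ofReal (A * ‖v‖ ^ 2))) := by
      have : Continuous fun w : H => ENNReal.ofReal (A * ‖w‖ ^ 2) :=
        ENNReal.continuous_ofReal.comp (by fun_prop)
      exact (this.tendsto v).comp hlim
    simp_rw [h1]
    refine (lintegral_liminf_le fun n =>
      (ENNReal.continuous_ofReal.comp (hcont (u n))).measurable).trans ?_
    rw [← h2.liminf_eq]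
    refine liminf_le_liminf (Eventually.of_forall fun n => ?_)
    obtain ⟨hi, hb⟩ := hloc (u n) (hu n)
    simp only [Function.comp_apply]
    rw [← ofReal_integral_eq_lintegral_ofReal hi (Eventually.of_forall fun g => by positivity)]
    exact ENNReal.ofReal_le_ofReal hb
  have hint : Integrable (fun g : G => ‖π.hom (c0Translate g χ) v‖ ^ 2) μ := by
    refine ⟨(hcont v).aestronglyMeasurable, ?_⟩
    rw [hasFiniteIntegral_iff_ofReal (Eventually.of_forall fun g => by positivity)]
    exact hF.trans_lt ENNReal.ofReal_lt_top
  refine ⟨hint, ?_⟩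
  rw [← ofReal_integral_eq_lintegral_ofReal hint (Eventually.of_forall fun g => by positivity)]
    at hF
  exact (ENNReal.ofReal_le_ofReal_iff (by positivity)).1 hF

/-- The partition of unity `∫ g(c)² dμ(g) = 1`, in the representation. -/
theorem isWeakIntegral_cutoff (hd : Dense {φ : C₀(E, ℂ) | HasCompactSupport φ}) {c : C₀(E, ℂ)}
    (hc : IsCutoff μ c) : IsWeakIntegral μ
      (fun g : G => π.hom (c0Translate g c) * π.hom (c0Translate g c)) 1 := by
  obtain ⟨A, hA, hP⟩ := π.exists_isSquareIntegrable μ hd hc.hasCompactSupport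
  have hcont := π.continuous_hom_c0Translate (G := G) hd c
  have hm : ∀ v, AEStronglyMeasurable (fun g : G => ‖π.hom (c0Translate g c) v‖) μ := fun v =>
    ((hcont.clm_apply continuous_const).norm).aestronglyMeasurable
  obtain ⟨R, hR⟩ := exists_isWeakIntegral (μ := μ) (K := 1)
    (f := fun g : G => π.hom (c0Translate g c) * π.hom (c0Translate g c)) zero_le_one hP hP hm hm
    (fun v w => (continuous_const.inner
      ((hcont.mul hcont).clm_apply continuous_const)).aestronglyMeasurable)
    (fun g v w => by
      rw [one_mul, mul_apply_eq_comp]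
      have h1 : inner ℂ v (π.hom (c0Translate g c) (π.hom (c0Translate g c) w))
          = inner ℂ (π.hom (c0Translate g c) v) (π.hom (c0Translate g c) w) := by
        rw [π.inner_hom_left, ← c0Translate_star, hc.star_eq]
      rw [h1]
      exact norm_inner_le_norm _ _)
  have h1 : R = 1 := by
    refine DFunLike.coe_injective (Continuous.ext_on (π.dense_isLocalized hd) R.continuous
      (1 : H →L[ℂ] H).continuous ?_)
    rintro w ⟨e, he, -, hw⟩
    have hψ : HasCompactSupport (c * c : C₀(E, ℂ)) := by
      have : HasCompactSupport (fun x => c x * c x) := hc.hasCompactSupport.mul_left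
      exact this
    refine ext_inner_left ℂ fun v => ?_
    rw [← (hR v w).2]
    obtain ⟨-, h2⟩ := π.integral_inner_of_localized μ hψ he hw v
    obtain ⟨-, h3⟩ := integral_c0Translate_mul μ hψ he
    -- The orbit integrals of c² equal 1, so the integral gives back e, which fixes w.
    have h4 : ∫ g : G, c0Translate g (c * c) * e ∂μ = e := by
      ext x
      rw [h3]
      have := hc.integral_sq x
      simp_rw [sq] at this
      simp_rw [ZeroAtInftyContinuousMap.mul_apply]
      rw [this, one_mul]
    simp_rw [← map_mul, ← c0Translate_mul]
    rw [h2, h4, hw]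
    rfl
  rwa [h1] at hR

end EquivariantRep

end ProperRepresentation

/-! ### Commutators with families of operators: continuity, decay and averages -/

theorem continuous_of_lipschitz_of_dense {G H : Type*} [TopologicalSpace G] [NormedAddCommGroup H]
    {F : H → G → ℂ} {K : ℝ} (hF : ∀ w w' g, ‖F w g - F w' g‖ ≤ K * ‖w - w'‖) {s : Set H}
    (hs : Dense s) (hc : ∀ w ∈ s, Continuous (F w)) (w : H) : Continuous (F w) := by
  refine continuous_of_uniform_approx_of_continuous fun u hu => ?_
  obtain ⟨ε, hε, hεu⟩ := Metric.mem_uniformity_dist.1 hu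
  obtain ⟨w', hw', hws⟩ := Metric.dense_iff.1 hs w (ε / (|K| + 1)) (by positivity)
  refine ⟨F w', hc w' hws, fun g => hεu ?_⟩
  rw [dist_eq_norm]
  have h1 : ‖w - w'‖ < ε / (|K| + 1) := by
    rw [← dist_eq_norm, dist_comm]
    exact hw'
  calc ‖F w g - F w' g‖ ≤ K * ‖w - w'‖ := hF _ _ _
    _ ≤ (|K| + 1) * ‖w - w'‖ := by gcongr; linarith [le_abs_self K]
    _ < (|K| + 1) * (ε / (|K| + 1)) := by gcongr
    _ = ε := by field_simp

theorem IsWeakIntegral.add {G H : Type*} [MeasurableSpace G] [NormedAddCommGroup H]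
    [InnerProductSpace ℂ H] {μ : Measure G} {f f' : G → H →L[ℂ] H} {R R' : H →L[ℂ] H}
    (h : IsWeakIntegral μ f R) (h' : IsWeakIntegral μ f' R') :
    IsWeakIntegral μ (fun g => f g + f' g) (R + R') := fun v w => by
  obtain ⟨i1, e1⟩ := h v w
  obtain ⟨i2, e2⟩ := h' v w
  simp only [_root_.add_apply, inner_add_right]
  exact ⟨i1.add i2, by rw [integral_add i1 i2, e1, e2]⟩

section

variable {G H : Type*} [TopologicalSpace G] [NormedAddCommGroup H] [InnerProductSpace ℂ H]
  [CompleteSpace H] {Γ : Submodule ℂ (H × H)} {L N Q T : H →L[ℂ] H}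

/-- A norm continuous family with bounded commutators `[A, P_g] = M_g`, uniformly in `g`, has weakly
continuous commutators. -/
theorem IsResolventPair.continuous_inner_commutator (h : IsResolventPair Γ L N)
    {P M : G → H →L[ℂ] H} (hP : Continuous P)
    (hPM : ∀ g {x y}, (x, y) ∈ Γ → (P g x, P g y + M g x) ∈ Γ) {C : ℝ} (hM : ∀ g, ‖M g‖ ≤ C)
    (v w : H) : Continuous fun g => inner ℂ v (M g w) := by
  have hd : Dense (Set.range L) :=
    ContinuousLinearMap.denseRange_of_isSelfAdjoint h.isSelfAdjoint_left h.left_injective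
  have hM' : ∀ g z, ‖M g z‖ ≤ C * ‖z‖ := fun g z => (M g).le_of_opNorm_le (hM g) z
  have h0 : ∀ z z', Continuous fun g => inner ℂ (L z) (M g (L z')) := fun z z' => by
    -- On vectors of the domain, symmetry moves A onto the left-hand vector, leaving only matrix
    -- coefficients of the continuous family P.
    have e : ∀ g, inner ℂ (L z) (M g (L z'))
        = inner ℂ (N z) (P g (L z')) - inner ℂ (L z) (P g (N z')) := fun g => by
      rw [h.inner_eq (h.mem_left z) (hPM g (h.mem_left z')), inner_add_right]
      ring
    simp_rw [e]
    fun_prop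
  have h1 : ∀ z w, Continuous fun g => inner ℂ (L z) (M g w) := fun z w =>
    continuous_of_lipschitz_of_dense (F := fun w g => inner ℂ (L z) (M g w)) (K := ‖L z‖ * C)
      (fun w w' g => by
        rw [← inner_sub_right, ← map_sub, mul_assoc]
        exact (norm_inner_le_norm _ _).trans (by gcongr; exact hM' _ _)) hd
      (by rintro _ ⟨z', rfl⟩; exact h0 z z') w
  exact continuous_of_lipschitz_of_dense (F := fun v g => inner ℂ v (M g w)) (K := C * ‖w‖)
      (fun v v' g => by
        rw [← inner_sub_left, mul_comm]
        exact (norm_inner_le_norm _ _).trans (by gcongr; exact hM' _ _)) hd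
      (by rintro _ ⟨z, rfl⟩; exact h1 z w) v

omit [TopologicalSpace G] in
/-- If `[A, P_g] = β_g P'_g` with `β_g` bounded and `P'_g → 0` strongly, then `[T, P_g] → 0` in norm. -/
theorem IsResolventPair.tendsto_commutator (h : IsResolventPair Γ L N) (hL : IsCompactOperator L)
    (hN : IsCompactOperator N) (hT : IsTransformPair Γ L Q T) {P P' β : G → H →L[ℂ] H}
    (hPM : ∀ g {x y}, (x, y) ∈ Γ → (P g x, P g y + (β g * P' g) x) ∈ Γ) {C C' : ℝ}
    (hβ : ∀ g, ‖β g‖ ≤ C) (hP' : ∀ g, ‖P' g‖ ≤ C') {l : Filter G} [l.IsCountablyGenerated]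
    (hlim : ∀ v, Tendsto (fun g => P' g v) l (𝓝 0)) :
    Tendsto (fun g => P g * T - T * P g) l (𝓝 0) := by
  have h1 : ∀ g, P g * T - T * P g
      = ((2 * Real.pi)⁻¹ : ℝ) • ∫ s : ℝ, commutatorIntegrand L N (β g * P' g) s := fun g =>
    h.commutator_eq_integral hT (hPM g)
  simp_rw [h1]
  rcases isEmpty_or_nonempty G with hG | ⟨⟨g₀⟩⟩
  · exact tendsto_of_isEmpty
  have hC : 0 ≤ C := (norm_nonneg _).trans (hβ g₀)
  have hpt : ∀ ε s : ℝ, Tendsto (fun g => resolventAt L N ε s * (β g * P' g) * resolventAt L N ε s) l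
      (𝓝 0) := fun ε s => by
    -- R M_g R = (R β_g)(P'_g R): the first factor is bounded, and the second tends to 0 in norm
    -- because R is compact.
    have h2 := tendsto_mul_of_isCompactOperator hP' hlim
      (IsResolventPair.isCompactOperator_resolventAt hL hN ε s)
    refine squeeze_zero_norm (a := fun g => ‖resolventAt L N ε s‖ * C *
      ‖P' g * resolventAt L N ε s‖) (fun g => ?_) ?_
    · rw [show resolventAt L N ε s * (β g * P' g) * resolventAt L N ε s
        = resolventAt L N ε s * β g * (P' g * resolventAt L N ε s) by noncomm_ring]
      refine (norm_mul_le _ _).trans ?_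
      gcongr
      exact (norm_mul_le _ _).trans (by gcongr; exact hβ g)
    · simpa using h2.norm.const_mul (‖resolventAt L N ε s‖ * C)
  have h3 : Tendsto (fun g => ∫ s : ℝ, commutatorIntegrand L N (β g * P' g) s) l
      (𝓝 (∫ _ : ℝ, (0 : H →L[ℂ] H))) := by
    refine tendsto_integral_filter_of_dominated_convergence
      (fun s => 2 * (C * C') * (1 + s ^ 2)⁻¹) ?_ ?_ (integrable_inv_one_add_sq.const_mul _) ?_
    · exact Eventually.of_forall fun g =>
        (h.continuous_commutatorIntegrand _).aestronglyMeasurable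
    · refine Eventually.of_forall fun g => Eventually.of_forall fun s => ?_
      refine (h.norm_commutatorIntegrand_le _ s).trans ?_
      gcongr
      refine (norm_mul_le _ _).trans ?_
      gcongr
      exacts [hβ g, hP' g]
    · refine Eventually.of_forall fun s => ?_
      simpa [commutatorIntegrand] using (hpt 1 s).add (hpt (-1) s)
  rw [integral_zero] at h3
  simpa using h3.const_smul ((2 * Real.pi)⁻¹ : ℝ)

end

section Average

variable {G H : Type*} [TopologicalSpace G] [SecondCountableTopology G] [MeasurableSpace G]
  [BorelSpace G] {μ : Measure G} [SFinite μ] [NormedAddCommGroup H] [InnerProductSpace ℂ H]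
  [CompleteSpace H] {Γ : Submodule ℂ (H × H)} {L N Q T : H →L[ℂ] H}

/-- If `P_g` and `P'_g` are square integrable and `[A, P_g] = β_g P'_g` with `β_g` uniformly bounded,
then the weak integral of `P_g [P_g, T]` exists and is compact. -/
theorem IsResolventPair.exists_compact_average (h : IsResolventPair Γ L N)
    (hL : IsCompactOperator L) (hN : IsCompactOperator N) (hT : IsTransformPair Γ L Q T)
    {P P' β : G → H →L[ℂ] H} (hPc : Continuous P) (hPc' : Continuous P')
    (hPs : ∀ g v w, inner ℂ v (P g w) = inner ℂ (P g v) w)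
    (hPM : ∀ g {x y}, (x, y) ∈ Γ → (P g x, P g y + (β g * P' g) x) ∈ Γ) {C C' A A' : ℝ}
    (hC : 0 ≤ C) (hA : 0 ≤ A) (hA' : 0 ≤ A')
    (hβ : ∀ g, ‖β g‖ ≤ C) (hP' : ∀ g, ‖P' g‖ ≤ C') (hPi : IsSquareIntegrable μ P A)
    (hPi' : IsSquareIntegrable μ P' A') :
    ∃ K : H →L[ℂ] H, IsCompactOperator K ∧
      IsWeakIntegral μ (fun g => P g * (P g * T - T * P g)) K := by
  set M : G → H →L[ℂ] H := fun g => β g * P' g with hMdef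
  have hMn : ∀ g, ‖M g‖ ≤ C * C' := fun g =>
    (norm_mul_le _ _).trans (mul_le_mul (hβ g) (hP' g) (norm_nonneg _) hC)
  have hMw := h.continuous_inner_commutator hPc hPM hMn
  have hm : ∀ v, AEStronglyMeasurable (fun g => ‖P g v‖) μ := fun v =>
    (hPc.clm_apply continuous_const).norm.aestronglyMeasurable
  have hm' : ∀ v, AEStronglyMeasurable (fun g => ‖P' g v‖) μ := fun v =>
    (hPc'.clm_apply continuous_const).norm.aestronglyMeasurable
  have hinner : ∀ (X : H →L[ℂ] H) (g : G) (v w : H), inner ℂ v ((P g * X * M g) w)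
      = inner ℂ (ContinuousLinearMap.adjoint X (P g v)) (M g w) := fun X g v w => by
    rw [ContinuousLinearMap.adjoint_inner_left, ← hPs]
    rfl
  have hbound : ∀ (X : H →L[ℂ] H) (g : G) (v w : H), ‖inner ℂ v ((P g * X * M g) w)‖
      ≤ ‖X‖ * C * (‖P g v‖ * ‖P' g w‖) := fun X g v w => by
    have e : inner ℂ v ((P g * X * M g) w) = inner ℂ (P g v) (X (β g (P' g w))) := hPs g v _
    rw [e]
    calc _ ≤ ‖P g v‖ * ‖X (β g (P' g w))‖ := norm_inner_le_norm _ _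
      _ ≤ ‖P g v‖ * (‖X‖ * (C * ‖P' g w‖)) := by
          gcongr
          refine (X.le_opNorm _).trans ?_
          gcongr
          exact (β g).le_of_opNorm_le (hβ g) _
      _ = _ := by ring
  -- Only X stands between P_g and M_g, so a fixed operator on the right can be pulled out of the
  -- weak integral. With X a resolvent, this produces the compact factor.
  have hex : ∀ X : H →L[ℂ] H, ∃ R, IsWeakIntegral μ (fun g => P g * X * M g) R := fun X =>
    exists_isWeakIntegral (K := ‖X‖ * C) (by positivity) hPi hPi' hm hm' (fun v w => by
      simp_rw [hinner]
      refine Continuous.aestronglyMeasurable ?_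
      exact continuous_inner_of_weak hMn hMw continuous_id
        ((ContinuousLinearMap.adjoint X).continuous.comp (hPc.clm_apply continuous_const))
        continuous_const) (hbound X)
  choose Φ hΦ using hex
  have hΦn : ∀ X, ‖Φ X‖ ≤ ‖X‖ * C * ((A + A') / 2) := fun X =>
    (hΦ X).norm_le hA hA' (by positivity) hPi hPi' hm hm' (hbound X)
  have hΦsub : ∀ X Y, Φ X - Φ Y = Φ (X - Y) := fun X Y => by
    refine IsWeakIntegral.unique ((hΦ X).sub (hΦ Y)) ?_
    convert hΦ (X - Y) using 2
    noncomm_ring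
  have hΦc : Continuous Φ := by
    refine (LipschitzWith.of_dist_le_mul (K := Real.toNNReal (C * ((A + A') / 2)))
      fun X Y => ?_).continuous
    rw [dist_eq_norm, dist_eq_norm, hΦsub, Real.coe_toNNReal _ (by positivity)]
    exact (hΦn _).trans (le_of_eq (by ring))
  -- the integral over `G` for a fixed parameter `s`
  set W : ℝ → H →L[ℂ] H := fun s => Φ (resolventAt L N 1 s) * resolventAt L N 1 s
    + Φ (resolventAt L N (-1) s) * resolventAt L N (-1) s with hW
  have hR := fun ε => h.continuous_resolventAt ε
  have hWw : ∀ s, IsWeakIntegral μ (fun g => P g * commutatorIntegrand L N (M g) s) (W s) :=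
    fun s => by
      have h1 := ((hΦ (resolventAt L N 1 s)).mul_const (resolventAt L N 1 s)).add
        ((hΦ (resolventAt L N (-1) s)).mul_const (resolventAt L N (-1) s))
      convert h1 using 2
      simp only [commutatorIntegrand]
      noncomm_ring
  have hsq : ∀ s : ℝ, (√(1 + s ^ 2))⁻¹ * (√(1 + s ^ 2))⁻¹ = (1 + s ^ 2)⁻¹ := fun s => by
    rw [← mul_inv, Real.mul_self_sqrt (by positivity)]
  have hW1 : ∀ ε s : ℝ, ε ^ 2 = 1 → ‖Φ (resolventAt L N ε s) * resolventAt L N ε s‖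
      ≤ C * ((A + A') / 2) * (1 + s ^ 2)⁻¹ := fun ε s hε => by
    have h1 := h.norm_resolventAt_le hε s
    calc _ ≤ ‖Φ (resolventAt L N ε s)‖ * ‖resolventAt L N ε s‖ := norm_mul_le _ _
      _ ≤ ((√(1 + s ^ 2))⁻¹ * C * ((A + A') / 2)) * (√(1 + s ^ 2))⁻¹ := by
          gcongr
          exact (hΦn _).trans (by gcongr)
      _ = C * ((A + A') / 2) * ((√(1 + s ^ 2))⁻¹ * (√(1 + s ^ 2))⁻¹) := by ring
      _ = _ := by rw [hsq]
  have hWc : Continuous W := by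
    have h1 := hR 1
    have h2 := hR (-1)
    exact ((hΦc.comp h1).mul h1).add ((hΦc.comp h2).mul h2)
  have hWi : Integrable W := by
    refine (integrable_inv_one_add_sq.const_mul (2 * (C * ((A + A') / 2)))).mono'
      hWc.aestronglyMeasurable (Eventually.of_forall fun s => ?_)
    refine (norm_add_le _ _).trans ?_
    have h1 := hW1 1 s (by norm_num)
    have h2 := hW1 (-1) s (by norm_num)
    linarith
  have hWk : ∀ s, IsCompactOperator (W s) := fun s =>
    IsCompactOperator.add
      ((IsResolventPair.isCompactOperator_resolventAt hL hN 1 s).clm_comp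
        (Φ (resolventAt L N 1 s)))
      ((IsResolventPair.isCompactOperator_resolventAt hL hN (-1) s).clm_comp
        (Φ (resolventAt L N (-1) s)))
  have hKc : IsCompactOperator (∫ s : ℝ, W s : H →L[ℂ] H) := IsCompactOperator.integral hWk
  refine ⟨((2 * Real.pi)⁻¹ : ℝ) • ∫ s : ℝ, W s, hKc.smul ((2 * Real.pi)⁻¹ : ℝ), fun v w => ?_⟩
  -- Fubini
  set F : ℝ → G → ℂ := fun s g => inner ℂ v ((P g * commutatorIntegrand L N (M g) s) w) with hF
  have hFe : ∀ s g, F s g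
      = inner ℂ v ((P g * resolventAt L N 1 s * M g) (resolventAt L N 1 s w))
      + inner ℂ v ((P g * resolventAt L N (-1) s * M g) (resolventAt L N (-1) s w)) :=
    fun s g => by
      rw [← inner_add_right]
      simp only [hF, commutatorIntegrand, mul_apply_eq_comp, _root_.add_apply, map_add]
  have hFc : Continuous (Function.uncurry F) := by
    have hp : ∀ ε : ℝ, Continuous fun p : ℝ × G =>
        inner ℂ v ((P p.2 * resolventAt L N ε p.1 * M p.2) (resolventAt L N ε p.1 w)) := fun ε => by
      simp_rw [hinner]
      refine continuous_inner_of_weak hMn hMw continuous_snd ?_ ?_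
      · exact ((ContinuousLinearMap.adjoint.continuous.comp (hR ε)).comp continuous_fst).clm_apply
          ((hPc.clm_apply continuous_const).comp continuous_snd)
      · exact ((hR ε).clm_apply continuous_const).comp continuous_fst
    have : Function.uncurry F = fun p : ℝ × G =>
        inner ℂ v ((P p.2 * resolventAt L N 1 p.1 * M p.2) (resolventAt L N 1 p.1 w))
        + inner ℂ v ((P p.2 * resolventAt L N (-1) p.1 * M p.2) (resolventAt L N (-1) p.1 w)) :=
      funext fun p => hFe p.1 p.2
    rw [this]
    exact (hp 1).add (hp (-1))
  -- Square integrability bounds the integral over G for fixed s; the resolvent appears twice, which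
  -- contributes the integrable factor (1 + s²)⁻¹.
  have hFi : Integrable (Function.uncurry F) ((volume : Measure ℝ).prod μ) := by
    rw [integrable_prod_iff hFc.aestronglyMeasurable]
    refine ⟨Eventually.of_forall fun s => (hWw s v w).1, ?_⟩
    have hFm := hFc.aestronglyMeasurable (μ := (volume : Measure ℝ).prod μ)
    refine (integrable_inv_one_add_sq.const_mul
      (2 * (C * ((A + A') / 2) * ‖v‖ * ‖w‖))).mono' hFm.norm.integral_prod_right'
      (Eventually.of_forall fun s => ?_)
    rw [Real.norm_of_nonneg (integral_nonneg fun _ => norm_nonneg _)]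
    have hε : ∀ ε : ℝ, ε ^ 2 = 1 →
        Integrable (fun g => ‖resolventAt L N ε s‖ * C *
          (‖P g v‖ * ‖P' g (resolventAt L N ε s w)‖)) μ ∧
        ∫ g, ‖resolventAt L N ε s‖ * C * (‖P g v‖ * ‖P' g (resolventAt L N ε s w)‖) ∂μ
          ≤ C * ((A + A') / 2) * ‖v‖ * ‖w‖ * (1 + s ^ 2)⁻¹ := fun ε hε => by
      obtain ⟨i, b⟩ := hPi.integral_mul_le hPi' hm hm' v (resolventAt L N ε s w)
      refine ⟨i.const_mul _, ?_⟩
      rw [integral_const_mul]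
      have h1 := h.norm_resolventAt_le hε s
      have h2 : ‖resolventAt L N ε s w‖ ≤ (√(1 + s ^ 2))⁻¹ * ‖w‖ :=
        (resolventAt L N ε s).le_of_opNorm_le h1 w
      calc _ ≤ (√(1 + s ^ 2))⁻¹ * C * ((A + A') / 2 * ‖v‖ * ((√(1 + s ^ 2))⁻¹ * ‖w‖)) := by
            gcongr
            exact b.trans (by gcongr)
        _ = C * ((A + A') / 2) * ‖v‖ * ‖w‖ * ((√(1 + s ^ 2))⁻¹ * (√(1 + s ^ 2))⁻¹) := by ring
        _ = _ := by rw [hsq]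
    obtain ⟨i1, b1⟩ := hε 1 (by norm_num)
    obtain ⟨i2, b2⟩ := hε (-1) (by norm_num)
    calc ∫ g, ‖Function.uncurry F (s, g)‖ ∂μ
        ≤ ∫ g, (‖resolventAt L N 1 s‖ * C * (‖P g v‖ * ‖P' g (resolventAt L N 1 s w)‖)
          + ‖resolventAt L N (-1) s‖ * C * (‖P g v‖ * ‖P' g (resolventAt L N (-1) s w)‖)) ∂μ := by
          refine integral_mono (hWw s v w).1.norm (i1.add i2) fun g => ?_
          change ‖F s g‖ ≤ _
          rw [hFe]
          exact (norm_add_le _ _).trans (add_le_add (hbound _ _ _ _) (hbound _ _ _ _))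
      _ ≤ _ := by
          rw [integral_add i1 i2]
          linarith
  have hcomm : ∀ g, inner ℂ v ((P g * (P g * T - T * P g)) w)
      = ((2 * Real.pi)⁻¹ : ℝ) • ∫ s : ℝ, F s g := fun g => by
    rw [h.commutator_eq_integral hT (hPM g)]
    have hi := h.integrable_commutatorIntegrand (M g)
    let Λ : (H →L[ℂ] H) →L[ℂ] ℂ := (innerSL ℂ v) ∘L (P g) ∘L (ContinuousLinearMap.apply ℂ H w)
    have h1 := Λ.integral_comp_comm hi
    have h2 : ∫ s : ℝ, F s g = ∫ s : ℝ, Λ (commutatorIntegrand L N (M g) s) := rfl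
    rw [h2, h1, ← ContinuousLinearMap.map_smul_of_tower]
    rfl
  simp_rw [hcomm]
  have h2 : ∫ s : ℝ, ∫ g, F s g ∂μ = inner ℂ v ((∫ s : ℝ, W s) w) := by
    let Λ : (H →L[ℂ] H) →L[ℂ] ℂ := (innerSL ℂ v) ∘L (ContinuousLinearMap.apply ℂ H w)
    have h1 := Λ.integral_comp_comm hWi
    have h3 : inner ℂ v ((∫ s : ℝ, W s) w) = Λ (∫ s : ℝ, W s) := rfl
    rw [h3, ← h1]
    exact integral_congr_ae (Eventually.of_forall fun s => (hWw s v w).2)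
  refine ⟨hFi.integral_prod_right.smul ((2 * Real.pi)⁻¹ : ℝ), ?_⟩
  rw [integral_smul, ← integral_integral_swap hFi, h2, _root_.smul_apply,
    RCLike.real_smul_eq_coe_smul (K := ℂ), RCLike.real_smul_eq_coe_smul (K := ℂ), inner_smul_right]
  rfl

end Average

/-- Dominated convergence along a filter needs a countable base; a compact exhaustion provides it at
infinity. -/
theorem isCountablyGenerated_cocompact (G : Type*) [TopologicalSpace G] [LocallyCompactSpace G]
    [SecondCountableTopology G] : (cocompact G).IsCountablyGenerated := by
  let K := CompactExhaustion.choice G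
  have h : (cocompact G).HasBasis (fun _ : ℕ => True) fun n => (K n)ᶜ := by
    refine hasBasis_cocompact.to_hasBasis (fun s hs => ?_) fun n _ => ⟨K n, K.isCompact n, subset_rfl⟩
    obtain ⟨n, hn⟩ := K.exists_superset_of_isCompact hs
    exact ⟨n, trivial, Set.compl_subset_compl.2 hn⟩
  exact HasCountableBasis.isCountablyGenerated ⟨h, Set.to_countable _⟩

/-! ### Properness of the bounded transform -/

section ProperConditions

variable {G H E : Type*} [Group G] [TopologicalSpace G] [IsTopologicalGroup G] [T2Space G]
  [LocallyCompactSpace G] [SecondCountableTopology G]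
  [NormedAddCommGroup H] [InnerProductSpace ℂ H] [CompleteSpace H] {S : GradedRep G H}
  [TopologicalSpace E] [T2Space E] [LocallyCompactSpace E] [MulAction G E] [ProperSMul G E]
  (π : EquivariantRep S E)

theorem norm_opCommutator_le (X T : H →L[ℂ] H) : ‖opCommutator X T‖ ≤ 2 * ‖T‖ * ‖X‖ := by
  calc ‖X * T - T * X‖ ≤ ‖X * T‖ + ‖T * X‖ := norm_sub_le _ _
    _ ≤ ‖X‖ * ‖T‖ + ‖T‖ * ‖X‖ := add_le_add (norm_mul_le _ _) (norm_mul_le _ _)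
    _ = _ := by ring

omit [IsTopologicalGroup G] [T2Space G] [LocallyCompactSpace G] [SecondCountableTopology G]
  [T2Space E] [LocallyCompactSpace E] in
theorem EquivariantRep.norm_opCommutator_sub_le (T : H →L[ℂ] H) (g : G) (φ ψ : C₀(E, ℂ)) :
    ‖opCommutator (π.hom (c0Translate g φ)) T - opCommutator (π.hom (c0Translate g ψ)) T‖
      ≤ 2 * ‖T‖ * ‖φ - ψ‖ := by
  have e : opCommutator (π.hom (c0Translate g φ)) T - opCommutator (π.hom (c0Translate g ψ)) T
      = opCommutator (π.hom (c0Translate g (φ - ψ))) T := by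
    rw [c0Translate_sub, map_sub]
    simp only [opCommutator]
    noncomm_ring
  rw [e]
  refine (norm_opCommutator_le _ _).trans ?_
  gcongr
  exact (π.norm_hom_le _).trans (norm_c0Translate g _).le

/-- Bounded commutators of `A` with a dense family of functions make the bounded transform proper. -/
theorem properConditions_of_isTransformPair [MeasurableSpace G] [BorelSpace G] (μ : Measure G)
    [μ.IsHaarMeasure] {Γ : Submodule ℂ (H × H)} {L N Q T : H →L[ℂ] H}
    (h : IsResolventPair Γ L N) (hL : IsCompactOperator L) (hN : IsCompactOperator N)
    (hT : IsTransformPair Γ L Q T) {B : Set C₀(E, ℂ)} (hBsupp : ∀ b ∈ B, HasCompactSupport b)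
    (hBdense : Dense B)
    (hcomm : ∀ b ∈ B, ∃ χ : C₀(E, ℂ), HasCompactSupport χ ∧ ∃ β : G → H →L[ℂ] H,
      (∃ C : ℝ, ∀ g, ‖β g‖ ≤ C) ∧ ∀ (g : G) {x y : H}, (x, y) ∈ Γ →
        (π.hom (c0Translate g b) x,
          π.hom (c0Translate g b) y + (β g * π.hom (c0Translate g χ)) x) ∈ Γ)
    (hcut : ∃ c ∈ B, IsCutoff μ c) : ProperConditions μ π T where
  commutator_continuous φ := by
    have hd : Dense {φ : C₀(E, ℂ) | HasCompactSupport φ} := hBdense.mono hBsupp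
    have := π.continuous_hom_c0Translate (G := G) hd φ
    unfold opCommutator
    fun_prop
  commutator_compact φ g := by
    have hcl : IsClosed {X : H →L[ℂ] H | IsCompactOperator X} := isClosed_setOfPred_isCompactOperator
    have hc : Continuous fun φ : C₀(E, ℂ) => opCommutator (π.hom (c0Translate g φ)) T := by
      refine (LipschitzWith.of_dist_le_mul (K := Real.toNNReal (2 * ‖T‖)) fun φ ψ => ?_).continuous
      rw [dist_eq_norm, dist_eq_norm, Real.coe_toNNReal _ (by positivity)]
      exact π.norm_opCommutator_sub_le T g φ ψ
    refine (closure_minimal (s := B) (fun b hb => ?_) (hcl.preimage hc)) (hBdense φ)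
    obtain ⟨χ, -, β, -, hβ⟩ := hcomm b hb
    exact h.isCompactOperator_commutator hL hN hT (hβ g)
  commutator_vanishing φ := by
    have hd : Dense {φ : C₀(E, ℂ) | HasCompactSupport φ} := hBdense.mono hBsupp
    have := isCountablyGenerated_cocompact G
    rw [Metric.tendsto_nhds]
    intro ε hε
    -- The commutator is 2‖T‖-Lipschitz in φ, uniformly in g; the added 1 avoids division by zero.
    obtain ⟨b, hb, hbB⟩ := Metric.dense_iff.1 hBdense φ (ε / 2 / (2 * ‖T‖ + 1)) (by positivity)
    obtain ⟨χ, hχ, β, ⟨C, hC⟩, hβ⟩ := hcomm b hbB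
    have h1 := h.tendsto_commutator hL hN hT hβ hC
      (fun g => (π.norm_hom_le _).trans (norm_c0Translate g χ).le)
      (π.tendsto_hom_c0Translate hd hχ)
    filter_upwards [Metric.tendsto_nhds.1 h1 (ε / 2) (by positivity)] with g hg
    rw [dist_zero_right] at hg ⊢
    have h2 := π.norm_opCommutator_sub_le T g φ b
    have h3 : ‖φ - b‖ < ε / 2 / (2 * ‖T‖ + 1) := by
      rw [← dist_eq_norm, dist_comm]
      exact hb
    have h4 : 2 * ‖T‖ * ‖φ - b‖ ≤ ε / 2 := by
      calc 2 * ‖T‖ * ‖φ - b‖ ≤ (2 * ‖T‖ + 1) * (ε / 2 / (2 * ‖T‖ + 1)) := by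
            gcongr
            linarith
        _ = ε / 2 := by field_simp
    have h5 := norm_sub_norm_le (opCommutator (π.hom (c0Translate g φ)) T)
      (opCommutator (π.hom (c0Translate g b)) T)
    have h6 : ‖opCommutator (π.hom (c0Translate g b)) T‖ < ε / 2 := hg
    linarith
  cutoff_average := by
    have hd : Dense {φ : C₀(E, ℂ) | HasCompactSupport φ} := hBdense.mono hBsupp
    obtain ⟨c, hcB, hc⟩ := hcut
    obtain ⟨χ, hχ, β, ⟨C, hC⟩, hβ⟩ := hcomm c hcB
    obtain ⟨A, hA, hPi⟩ := π.exists_isSquareIntegrable μ hd hc.hasCompactSupport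
    obtain ⟨A', hA', hPi'⟩ := π.exists_isSquareIntegrable μ hd hχ
    obtain ⟨K, hK, hKw⟩ := h.exists_compact_average (μ := μ) hL hN hT
      (π.continuous_hom_c0Translate hd c) (π.continuous_hom_c0Translate hd χ)
      (fun g v w => by rw [π.inner_hom_left, ← c0Translate_star, hc.star_eq]) hβ
      ((norm_nonneg _).trans (hC 1)) hA hA' hC
      (fun g => (π.norm_hom_le _).trans (norm_c0Translate g χ).le) hPi hPi'
    -- With P = g(c), P T P = P² T - P [P, T]; the two terms integrate to 1 · T and K.
    refine ⟨c, hc, 1 * T - K, ?_, ?_⟩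
    · convert ((π.isWeakIntegral_cutoff μ hd hc).mul_const T).sub hKw using 2
      noncomm_ring
    · have e : 1 * T - K - T = -K := by
        rw [one_mul]
        abel
      rw [e]
      exact hK.neg

end ProperConditions

/-! ### The main theorem -/

theorem theorem6p1
    {G : Type u} [Group G] [TopologicalSpace G] [IsTopologicalGroup G] [T2Space G]
    [LocallyCompactSpace G] [SecondCountableTopology G] [MeasurableSpace G] [BorelSpace G]
    (μ : Measure G) [μ.IsHaarMeasure]
    {E : Type v} [TopologicalSpace E] [T2Space E] [LocallyCompactSpace E] [MulAction G E]
    [ProperSMul G E] [CompactSpace (MulAction.orbitRel.Quotient G E)]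
    (hE : IsUniversalProper G E)
    {H : Type*} [NormedAddCommGroup H] [InnerProductSpace ℂ H] [CompleteSpace H]
    [TopologicalSpace.SeparableSpace H] (S : GradedRep G H)
    (D : H →ₗ.[ℂ] H) (hDsa : IsEssentiallySelfAdjoint D) (hDodd : IsOddOperator S D)
    (hDres : HasCompactResolvent D.closure) (hDeq : IsAlmostEquivariant S D)
    (π : EquivariantRep S E)
    (B : NonUnitalSubalgebra ℂ C₀(E, ℂ)) (hBsupp : ∀ b ∈ B, HasCompactSupport b)
    (hBG : ∀ g : G, ∀ b ∈ B, c0Translate g b ∈ B) (hBdense : Dense (B : Set C₀(E, ℂ)))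
    (hBdom : ∀ b ∈ B, ∀ x : D.domain, π.hom b x ∈ D.domain)
    (hcomm : ∀ b, ∀ hb : b ∈ B, ∃ χ : C₀(E, ℂ), HasCompactSupport χ ∧
      ∃ β : G → H →L[ℂ] H, (∃ C : ℝ, ∀ g, ‖β g‖ ≤ C) ∧
        ∀ (g : G) (x : D.domain),
          D ⟨π.hom (c0Translate g b) x, hBdom _ (hBG g b hb) x⟩ - π.hom (c0Translate g b) (D x)
            = β g (π.hom (c0Translate g χ) x))
    (hcut : ∃ c ∈ B, IsCutoff μ c) :
    (∃! T : H →L[ℂ] H, IsBoundedTransform D.closure T) ∧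
    ∀ T : H →L[ℂ] H, IsBoundedTransform D.closure T →
      IsProperCycle μ E S T ∧ ProperConditions μ π T ∧
      (IsUnitOnCompacts S T → HasPropertyGamma μ E S T) := by
  obtain ⟨L, N, h, hL, hN⟩ := hDres.exists_isResolventPair hDsa
  -- The commutator identity is carried from D to its closure, with the same χ and β.
  have hΓ : ∀ b ∈ B, ∃ χ : C₀(E, ℂ), HasCompactSupport χ ∧ ∃ β : G → H →L[ℂ] H,
      (∃ C : ℝ, ∀ g, ‖β g‖ ≤ C) ∧ ∀ (g : G) {x y : H}, (x, y) ∈ D.closure.graph →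
        (π.hom (c0Translate g b) x, π.hom (c0Translate g b) y +
          (β g * π.hom (c0Translate g χ)) x) ∈ D.closure.graph := by
    intro b hb
    obtain ⟨χ, hχ, β, hβ, hx⟩ := hcomm b hb
    refine ⟨χ, hχ, β, hβ, fun g {x y} hxy => ?_⟩
    refine hDsa.map_mem_graph (f := fun p : H × H => (π.hom (c0Translate g b) p.1,
      π.hom (c0Translate g b) p.2 + (β g * π.hom (c0Translate g χ)) p.1)) (by fun_prop)
      (fun x => ?_) hxy
    exact LinearPMap.mem_graph_of_apply_eq (sub_eq_iff_eq_add'.1 (hx g x))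
  have hmain : ∀ T : H →L[ℂ] H, IsBoundedTransform D.closure T →
      IsKasparovCycle S T ∧ ProperConditions μ π T := fun T hT => by
    obtain ⟨Q, hQ⟩ := hT.exists_isTransformPair h
    exact ⟨isKasparovCycle_of_isTransformPair hDsa hDodd hDeq h hL hN hQ,
      properConditions_of_isTransformPair π μ h hL hN hQ hBsupp hBdense hΓ hcut⟩
  refine ⟨?_, fun T hT => ?_⟩
  · obtain ⟨Q, T, hQT⟩ := h.exists_isTransformPair
    refine ⟨T, hQT.isBoundedTransform h, fun T' hT' => ?_⟩
    obtain ⟨Q', hQT'⟩ := IsBoundedTransform.exists_isTransformPair h hT'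
    exact hQT'.unique hQT h
  · obtain ⟨h1, h2⟩ := hmain T hT
    exact ⟨⟨h1, π, h2⟩, h2, fun hu => ⟨h1, hu, π, h2⟩⟩
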